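/- Let $p>2$ be a prime, $\mathbb{F}:=\mathbb{F}_p(x_{11},x_{12},x_{21},x_{22})$ the field of rational functions in four variables, and $G=(\mathbb{Z}/p)^2=\langle e_1,e_2\rangle$. For $c_1,c_2\in\mathbb{F}$ put $$\sigma(c_1,c_2)=\begin{pmatrix}1&2c_1&c_1^2+c_2\\0&1&c_1\\0&0&1\end{pmatrix},$$ and let $V_3=\mathbb{F}^3$ be the representation of $G$ given by $e_j\mapsto\sigma(x_{1j},x_{2j})$ (the generic rank two representation). Let $x=[0\;0\;1]$, $y=[0\;1\;0]$, $z=[1\;0\;0]$ be the basis of $V_3^*$, on which $G$ acts from the right, so that $x\sigma(c_1,c_2)=x$, $y\sigma(c_1,c_2)=y+c_1x$, $z\sigma(c_1,c_2)=z+2c_1y+(c_1^2+c_2)x$, and let $\mathbb{F}[V_3]^G\subset\mathbb{F}[x,y,z]$ be the ring of invariants. Use the graded reverse lexicographic order with $z>y>x$. Let $N_G(z)$ be the product of the elements of the $G$-orbit of $z$, and $\delta=y^2-xz$. Let $\Gamma$ be the $6\times2$ matrix with rows $(x_{11},x_{12})$, $(x_{21},x_{22})$, $(x_{11}^p,x_{12}^p)$,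 $(x_{21}^p,x_{22}^p)$, $(x_{11}^{p^2},x_{12}^{p^2})$, $(x_{21}^{p^2},x_{22}^{p^2})$, and let $\gamma_{ij}$ be its minor on rows $i,j$. Let $\tilde f_{ijk}$ be the minor on rows $i,j,k$ of the $6\times 3$ matrix obtained by appending to $\Gamma$ the column $[y/x,\,-\delta/x^2,\,(y/x)^p,\,(-\delta/x^2)^p,\,(y/x)^{p^2},\,(-\delta/x^2)^{p^2}]^T$, and let $f_{ijk}\in\mathbb{F}[x,y,z]$ be $x^m\tilde f_{ijk}$ for the least integer $m\ge0$ for which this is a polynomial. Put $f_1:=f_{123}$ and $$f_2:=\frac{\gamma_{12}f_{124}+f_1^2}{2x^{p-2}},$$ which is a polynomial. A subset $\mathcal{B}$ of a subalgebra $A$ of a polynomial ring is a SAGBI basis of $A$ if the lead monomials of the elements of $\mathcal{B}$ generate the algebra generated by the lead terms of the elements of $A$. A subduction of $f$ with respect to $\mathcal{B}=\{b_1,\dots,b_\ell\}$ is a sequence of steps, each of which replaces a nonzero polynomial $g$ by $g-c\,b^I$, where $c$ is a scalar and $b^I=\prod_j b_j^{i_j}$ a product with $\mathrm{LT}(c\,b^I)=\mathrm{LT}(g)$.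 Then: (i) $\mathcal{B}=\{x,f_1,f_2,N_G(z)\}$ is a SAGBI basis of $\mathbb{F}[V_3]^G$, and it generates $\mathbb{F}[V_3]^G$ as an $\mathbb{F}$-algebra. (ii) $\gamma_{13}^pf_1^{p+2}-\gamma_{12}^2f_2^p$ subducts to zero with respect to $\mathcal{B}$. For every such subduction to zero, let $P\in\mathbb{F}[T_0,T_1,T_2,T_3]$ be the sum of the terms $c\,T^I$ for the multiples $c\,b^I$ subtracted in its steps, with $T_0,T_1,T_2,T_3$ standing for $x,f_1,f_2,N_G(z)$. Then $$R=\gamma_{13}^pT_1^{p+2}-\gamma_{12}^2T_2^p-P$$ is nonzero and generates the kernel of the algebra homomorphism $\mathbb{F}[T_0,T_1,T_2,T_3]\to\mathbb{F}[V_3]^G$ with $T_0\mapsto x$, $T_1\mapsto f_1$, $T_2\mapsto f_2$, $T_3\mapsto N_G(z)$. Thus $\mathbb{F}[V_3]^G\cong\mathbb{F}[T_0,T_1,T_2,T_3]/(R)$ is a hypersurface. -/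

import Mathlib

open MvPolynomial

noncomputable section

/-! ### The graded reverse lexicographic order in three variables

Variables are indexed by `Fin 3`, with `0` for `z`, `1` for `y` and `2` for `x`; so `z > y > x`. -/

/-- Exponent vectors of monomials in `z, y, x`, to be ordered by grevlex. -/
def GrevlexExp : Type := Fin 3 →₀ ℕ

namespace GrevlexExp

instance : AddCommMonoid GrevlexExp := inferInstanceAs (AddCommMonoid (Fin 3 →₀ ℕ))

/-- Comparing partial sums `(a₀ + a₁ + a₂, a₀ + a₁, a₀)` lexicographically is grevlex;
see `grevlex_lt_iff`. -/
def key (a : GrevlexExp) : ℕ ×ₗ (ℕ ×ₗ ℕ) :=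
  let b : Fin 3 →₀ ℕ := a
  toLex (b 0 + b 1 + b 2, toLex (b 0 + b 1, b 0))

theorem key_injective : Function.Injective key := by
  intro a b h
  simp only [key, EmbeddingLike.apply_eq_iff_eq, Prod.mk.injEq] at h
  refine Finsupp.ext (fun i => ?_)
  fin_cases i <;> simp <;> omega

theorem key_add (a b : GrevlexExp) : key (a + b) = key a + key b := by
  have h : ∀ i, (show Fin 3 →₀ ℕ from a + b) i
      = (show Fin 3 →₀ ℕ from a) i + (show Fin 3 →₀ ℕ from b) i := fun i => rfl
  simp only [key]
  rw [← toLex_add, Prod.mk_add_mk, ← toLex_add, Prod.mk_add_mk]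
  simp only [EmbeddingLike.apply_eq_iff_eq, Prod.mk.injEq]
  have h0 := h 0
  have h1 := h 1
  have h2 := h 2
  simp only at h0 h1 h2
  omega

instance : LinearOrder GrevlexExp := LinearOrder.lift' key key_injective

theorem le_iff_key (a b : GrevlexExp) : a ≤ b ↔ key a ≤ key b := Iff.rfl

theorem lt_iff_key (a b : GrevlexExp) : a < b ↔ key a < key b := Iff.rfl

instance : IsOrderedAddMonoid GrevlexExp where
  add_le_add_left a b h c := by
    rw [le_iff_key, key_add, key_add]
    exact add_le_add (show key a ≤ key b from h) le_rfl

instance : WellFoundedLT GrevlexExp := ⟨InvImage.wf key wellFounded_lt⟩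

end GrevlexExp

/-- The graded reverse lexicographic order with `z > y > x`. -/
def grevlex : MonomialOrder (Fin 3) where
  syn := GrevlexExp
  toSyn := { Equiv.refl (Fin 3 →₀ ℕ) with map_add' := fun _ _ => rfl }
  toSyn_monotone := by
    intro a b h
    have h0 := h 0
    have h1 := h 1
    have h2 := h 2
    change GrevlexExp.key a ≤ GrevlexExp.key b
    simp only [GrevlexExp.key, Prod.Lex.toLex_le_toLex]
    omega

theorem grevlex_lt_iff (a b : Fin 3 →₀ ℕ) :
    grevlex.toSyn a < grevlex.toSyn b ↔
      a.degree < b.degree ∨ a.degree = b.degree ∧ (b 2 < a 2 ∨ b 2 = a 2 ∧ b 1 < a 1) := by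
  change GrevlexExp.key a < GrevlexExp.key b ↔ _
  simp only [GrevlexExp.key, Prod.Lex.toLex_lt_toLex, Finsupp.degree_eq_sum, Fin.sum_univ_three]
  omega

/-! ### SAGBI bases and subduction -/

/-- The lead monomial of `f` (a product of variables, with coefficient `1`). -/
def leadMonomial {σ F : Type*} [Field F] (m : MonomialOrder σ) (f : MvPolynomial σ F) :
    MvPolynomial σ F :=
  monomial (m.degree f) 1

/-- The lead term algebra of a subalgebra `A`: the algebra generated by the lead terms of the
elements of `A`. -/
def leadTermAlgebra {σ F : Type*} [Field F] (m : MonomialOrder σ)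
    (A : Subalgebra F (MvPolynomial σ F)) : Subalgebra F (MvPolynomial σ F) :=
  Algebra.adjoin F (m.leadingTerm '' (A : Set (MvPolynomial σ F)))

/-- `B` is a SAGBI basis of `A`: `B ⊆ A`, and the lead monomials of the elements of `B` generate
the lead term algebra of `A`. -/
def IsSagbiBasis {σ F : Type*} [Field F] (m : MonomialOrder σ)
    (A : Subalgebra F (MvPolynomial σ F)) (B : Set (MvPolynomial σ F)) : Prop :=
  B ⊆ (A : Set (MvPolynomial σ F)) ∧
    Algebra.adjoin F (leadMonomial m '' B) = leadTermAlgebra m A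

/-- `Subducts m b f P h`: there is a sequence of subduction steps with respect to the family `b`
that takes `f` to `h`. A step subtracts from a nonzero polynomial a scalar multiple `c • b ^ I` of
a product of members of the family that has the same lead term. The polynomial `P`, in one variable
for each member of the family, is the sum of all the `c • T ^ I` of the sequence. -/
inductive Subducts {σ ι F : Type*} [Field F] (m : MonomialOrder σ) (b : ι → MvPolynomial σ F) :
    MvPolynomial σ F → MvPolynomial ι F → MvPolynomial σ F → Prop
  | refl (f : MvPolynomial σ F) : Subducts m b f 0 f
  | step (f h : MvPolynomial σ F) (P : MvPolynomial ι F) (I : ι →₀ ℕ) (c : F) (hf : f ≠ 0)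
      (hlt : m.leadingTerm f = m.leadingTerm (aeval b (monomial I c)))
      (hs : Subducts m b (f - aeval b (monomial I c)) P h) :
      Subducts m b f (monomial I c + P) h

/-! ### The representation of `(ℤ/p)²` given by a `2 × 2` matrix, and its invariants -/

/-- The matrix `σ(c₁, c₂)`. -/
def sigmaMat {F : Type*} [Field F] (c₁ c₂ : F) : Matrix (Fin 3) (Fin 3) F :=
  !![1, 2 * c₁, c₁ ^ 2 + c₂; 0, 1, c₁; 0, 0, 1]

/-- The homomorphism `σ : (F², +) → GL₃(F)`. -/
def sigmaHom (F : Type*) [Field F] : Multiplicative (F × F) →* GL (Fin 3) F :=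
  MonoidHom.toHomUnits
    { toFun := fun c => sigmaMat c.toAdd.1 c.toAdd.2
      map_one' := by
        ext i j
        fin_cases i <;> fin_cases j <;> simp [sigmaMat]
      map_mul' := by
        intro c d
        ext i j
        fin_cases i <;> fin_cases j <;>
          simp [sigmaMat, Matrix.mul_apply, Fin.sum_univ_three] <;> ring }

/-- The elementary abelian group `(ℤ/p)²`. -/
abbrev ElemAb (p : ℕ) : Type := Multiplicative (Fin 2 → ZMod p)

/-- The three dimensional representation of `(ℤ/p)² = ⟨e₁, e₂⟩` with `eⱼ ↦ σ(M₁ⱼ, M₂ⱼ)`. -/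
def repHom (p : ℕ) {F : Type*} [Field F] [Algebra (ZMod p) F] (M : Matrix (Fin 2) (Fin 2) F) :
    ElemAb p →* GL (Fin 3) F :=
  (sigmaHom F).comp <| AddMonoidHom.toMultiplicative
    { toFun := fun a => (∑ j, a j • M 0 j, ∑ j, a j • M 1 j)
      map_zero' := by simp
      map_add' := by
        intro a b
        simp [add_smul]
        exact ⟨by ring, by ring⟩ }

/-- The right action of a matrix on `F[z, y, x]`. The linear forms `z, y, x` are the row vectors
`[1 0 0], [0 1 0], [0 0 1]`, and a matrix acts on them by multiplication on the right. -/
def polyAct {F : Type*} [Field F] (A : Matrix (Fin 3) (Fin 3) F) :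
    MvPolynomial (Fin 3) F →ₐ[F] MvPolynomial (Fin 3) F :=
  aeval fun i => ∑ j, C (A i j) * X j

/-- The ring of invariants `F[V_M]^G` for `G = (ℤ/p)²`. -/
def invariants (p : ℕ) {F : Type*} [Field F] [Algebra (ZMod p) F]
    (M : Matrix (Fin 2) (Fin 2) F) : Subalgebra F (MvPolynomial (Fin 3) F) :=
  ⨅ g : ElemAb p, AlgHom.equalizer (polyAct (repHom p M g).val) (AlgHom.id F _)

/-- The variable `z`. -/
def varZ (F : Type*) [Field F] : MvPolynomial (Fin 3) F := X 0

/-- The variable `y`. -/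
def varY (F : Type*) [Field F] : MvPolynomial (Fin 3) F := X 1

/-- The variable `x`. -/
def varX (F : Type*) [Field F] : MvPolynomial (Fin 3) F := X 2

/-- `δ = y² - xz`. -/
def delta (F : Type*) [Field F] : MvPolynomial (Fin 3) F := varY F ^ 2 - varX F * varZ F

open Classical in
/-- The orbit product `N_G(f)`: the product of the elements of the `G`-orbit of `f`. -/
def orbitNorm (p : ℕ) [NeZero p] {F : Type*} [Field F] [Algebra (ZMod p) F]
    (M : Matrix (Fin 2) (Fin 2) F) (f : MvPolynomial (Fin 3) F) : MvPolynomial (Fin 3) F :=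
  ∏ h ∈ Finset.univ.image (fun g : ElemAb p => polyAct (repHom p M g).val f), h

/-! ### The minors `γ_I` and `f_J` -/

/-- The `6 × 2` matrix `Γ` with rows `M₁, M₂, M₁^p, M₂^p, M₁^{p²}, M₂^{p²}` (entrywise powers). Rows
are numbered from `0`. -/
def Gam (p : ℕ) {F : Type*} [Field F] (M : Matrix (Fin 2) (Fin 2) F) : Matrix (Fin 6) (Fin 2) F :=
  Matrix.of ![M 0, M 1, M 0 ^ p, M 1 ^ p, M 0 ^ p ^ 2, M 1 ^ p ^ 2]

/-- The `2 × 2` minor of `Γ` with rows `I`. -/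
def gam (p : ℕ) {F : Type*} [Field F] (M : Matrix (Fin 2) (Fin 2) F) (I : Fin 2 → Fin 6) : F :=
  ((Gam p M).submatrix I id).det

/-- The column `[y/x, -δ/x², (y/x)^p, (-δ/x²)^p, (y/x)^{p²}, (-δ/x²)^{p²}]`. -/
def vCol (p : ℕ) (F : Type*) [Field F] : Fin 6 → FractionRing (MvPolynomial (Fin 3) F) :=
  let ι := algebraMap (MvPolynomial (Fin 3) F) (FractionRing (MvPolynomial (Fin 3) F))
  let u := ι (varY F) / ι (varX F)
  let w := -ι (delta F) / ι (varX F) ^ 2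
  ![u, w, u ^ p, w ^ p, u ^ p ^ 2, w ^ p ^ 2]

/-- The `6 × 3` matrix obtained from `Γ` by appending the column `vCol`. -/
def GamTilde (p : ℕ) {F : Type*} [Field F] (M : Matrix (Fin 2) (Fin 2) F) :
    Matrix (Fin 6) (Fin 3) (FractionRing (MvPolynomial (Fin 3) F)) :=
  let ι := algebraMap (MvPolynomial (Fin 3) F) (FractionRing (MvPolynomial (Fin 3) F))
  Matrix.of fun i => ![ι (C (Gam p M i 0)), ι (C (Gam p M i 1)), vCol p F i]

/-- The `3 × 3` minor of the augmented matrix with rows `J`. -/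
def fTilde (p : ℕ) {F : Type*} [Field F] (M : Matrix (Fin 2) (Fin 2) F) (J : Fin 3 → Fin 6) :
    FractionRing (MvPolynomial (Fin 3) F) :=
  ((GamTilde p M).submatrix J id).det

open Classical in
/-- For `g ∈ F[x, y, z][1/x]`, the polynomial obtained by minimally clearing the denominator of
`g`: it is `x ^ k * g` for the least `k` such that this is a polynomial. -/
def clearX {F : Type*} [Field F] (g : FractionRing (MvPolynomial (Fin 3) F)) :
    MvPolynomial (Fin 3) F :=
  if h : ∃ k : ℕ, ∃ f : MvPolynomial (Fin 3) F, algebraMap _ (FractionRing _) f =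
      algebraMap (MvPolynomial (Fin 3) F) (FractionRing _) (varX F) ^ k * g
  then (Nat.find_spec h).choose else 0

/-- The polynomial `f_J`. -/
def fMinor (p : ℕ) {F : Type*} [Field F] (M : Matrix (Fin 2) (Fin 2) F) (J : Fin 3 → Fin 6) :
    MvPolynomial (Fin 3) F :=
  clearX (fTilde p M J)

/-- `f₁ = f₁₂₃`. -/
def fOne (p : ℕ) {F : Type*} [Field F] (M : Matrix (Fin 2) (Fin 2) F) : MvPolynomial (Fin 3) F :=
  fMinor p M ![0, 1, 2]

/-- `f₂ = (γ₁₂ f₁₂₄ + f₁²) / (2 x^{p-2})`; `divMonomial` divides by the monomial `x^{p-2}`. -/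
def fTwo (p : ℕ) {F : Type*} [Field F] (M : Matrix (Fin 2) (Fin 2) F) : MvPolynomial (Fin 3) F :=
  C (2⁻¹ : F) *
    (C (gam p M ![0, 1]) * fMinor p M ![0, 1, 3] + fOne p M ^ 2).divMonomial
      (Finsupp.single 2 (p - 2))

/-- The generators `x, f₁, f₂, N_G(z)`. -/
def gens (p : ℕ) [NeZero p] {F : Type*} [Field F] [Algebra (ZMod p) F]
    (M : Matrix (Fin 2) (Fin 2) F) : Fin 4 → MvPolynomial (Fin 3) F :=
  ![varX F, fOne p M, fTwo p M, orbitNorm p M (varZ F)]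

/-! ### The generic representation -/

/-- The field `𝔽_p(x₁₁, x₁₂, x₂₁, x₂₂)`. -/
abbrev GenField (p : ℕ) : Type := FractionRing (MvPolynomial (Fin 2 × Fin 2) (ZMod p))

/-- The generic matrix `(x_{ij})`. -/
def genMat (p : ℕ) : Matrix (Fin 2) (Fin 2) (GenField p) :=
  Matrix.of fun i j => algebraMap (MvPolynomial (Fin 2 × Fin 2) (ZMod p)) (GenField p) (X (i, j))

end

/-! Rows are counted from `0` in the code, so `gam p M ![0, 1]`, `gam p M ![0, 2]` and `fMinor p M
![0, 1, 3]` are γ₁₂, γ₁₃ and f₁₂₄. Everything is proved for any `M` with γ₁₂ ≠ 0 and γ₁₃ ≠ 0, and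
the generic matrix satisfies both.

Invert x. Since f₁ is linear in z with coefficient -γ₁₃x^{p-1}, the elements x, f₁, y become
coordinates; G fixes x and f₁ and translates y by multiples of x. A polynomial in y over F[x, f₁]
that is invariant under these p² translations is a polynomial in the orbit product N(y)
(`exists_comp_normPoly`). Up to a scalar and a power of x, f₁₂₄ has degree p² in y with scalar
leading coefficient, so it is linear in N(y). Hence N(y) = α x^e f₂ + b(x, f₁) with α ≠ 0
(`exists_coordHom_normPoly_eq`), and x, f₁, f₂ generate the invariants after inverting x.

In the same coordinates N_G(z), times a scalar and a power of x, has degree p³ in y, so it is a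
polynomial of degree p in N(y). Substituting for N(y) gives a relation with leading term c T₀^i T₂^p
in T₂ (`exists_relation`). The lead monomials x, y^p, y^{p+2}, z^{p²} have no multiplicative
coincidence among products with T₂-exponent below p, and this persists modulo x for the last three.
So a polynomial of T₂-degree below p whose value is divisible by x is divisible by T₀
(`X_zero_dvd_of_varX_dvd`). This strips T₀^i off the relation (`exists_monic_relation`).

Division by the monic relation T₂^p + r gives every element of F[x, f₁, f₂, N_G(z)] a normal form of
T₂-degree below p. The divisibility result then shows that this algebra is closed under division by
x, so it is the whole invariant ring. Lead terms in a normal form cannot cancel, which gives the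
SAGBI property and shows that T₂^p + r generates the kernel. Finally R lies in the kernel, and a
degree bound leaves T₂^p as its only possible monomial of T₂-exponent at least p, so R is a scalar
multiple of T₂^p + r (`relation_of_subducts`). -/

noncomputable section

/-! ### Lead monomials of polynomial expressions -/

section Lead

variable {σ ι F : Type*} [Field F]

/-- The lead exponent of the product `b ^ I`. -/
def leadExp (m : MonomialOrder σ) (b : ι → MvPolynomial σ F) : (ι →₀ ℕ) →ₗ[ℕ] (σ →₀ ℕ) :=
  Finsupp.linearCombination ℕ fun i => m.degree (b i)

theorem aeval_monomial_ne_zero {b : ι → MvPolynomial σ F} (hb : ∀ i, b i ≠ 0) (I : ι →₀ ℕ)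
    {c : F} (hc : c ≠ 0) : aeval b (monomial I c) ≠ 0 := by
  rw [aeval_monomial]
  refine mul_ne_zero (by simpa [algebraMap_eq] using hc) ?_
  rw [Finsupp.prod, Finset.prod_ne_zero_iff]
  exact fun i _ => pow_ne_zero _ (hb i)

theorem degree_aeval_monomial (m : MonomialOrder σ) {b : ι → MvPolynomial σ F}
    (hb : ∀ i, b i ≠ 0) (I : ι →₀ ℕ) {c : F} (hc : c ≠ 0) :
    m.degree (aeval b (monomial I c)) = leadExp m b I := by
  have hprod : (I.prod fun i k => b i ^ k) ≠ 0 := by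
    rw [Finsupp.prod, Finset.prod_ne_zero_iff]
    exact fun i _ => pow_ne_zero _ (hb i)
  rw [aeval_monomial, algebraMap_eq, m.degree_mul (by simpa using hc) hprod, m.degree_C, zero_add,
    Finsupp.prod, m.degree_prod fun i _ => pow_ne_zero _ (hb i), leadExp,
    Finsupp.linearCombination_apply, Finsupp.sum]
  exact Finset.sum_congr rfl fun i _ => m.degree_pow _ _

/-- If the lead monomials of the products `b ^ I` occurring in `r` are distinct, then `r` does not
vanish at `b` and its value has the lead monomial of one of these products. -/
theorem aeval_ne_zero_of_injOn (m : MonomialOrder σ) {b : ι → MvPolynomial σ F}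
    (hb : ∀ i, b i ≠ 0) {r : MvPolynomial ι F} (hr : r ≠ 0)
    (hinj : Set.InjOn (leadExp m b) (r.support : Set (ι →₀ ℕ))) :
    aeval b r ≠ 0 ∧ ∃ I ∈ r.support, m.degree (aeval b r) = leadExp m b I := by
  classical
  obtain ⟨I, hI, hmax⟩ := r.support.exists_max_image (fun I => m.toSyn (leadExp m b I))
    (Finset.nonempty_of_ne_empty fun h => hr (support_eq_empty.1 h))
  have hsum : aeval b r = ∑ J ∈ r.support, aeval b (monomial J (r.coeff J)) := by
    conv_lhs => rw [r.as_sum]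
    rw [map_sum]
  -- By injectivity only the maximal `I` contributes to this coefficient.
  have hcoeff : (aeval b r).coeff (leadExp m b I) ≠ 0 := by
    rw [hsum, coeff_sum, Finset.sum_eq_single I]
    · rw [← degree_aeval_monomial m hb I (mem_support_iff.1 hI), m.coeff_degree_ne_zero_iff]
      exact aeval_monomial_ne_zero hb I (mem_support_iff.1 hI)
    · intro J hJ hne
      apply m.coeff_eq_zero_of_lt
      rw [degree_aeval_monomial m hb J (mem_support_iff.1 hJ)]
      refine lt_of_le_of_ne (hmax J hJ) fun h => hne (hinj hJ hI (m.toSyn.injective h))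
    · exact fun h => absurd hI h
  have hle : m.toSyn (m.degree (aeval b r)) ≤ m.toSyn (leadExp m b I) := by
    rw [hsum]
    refine m.degree_sum_le.trans (Finset.sup_le fun J hJ => ?_)
    rw [degree_aeval_monomial m hb J (mem_support_iff.1 hJ)]
    exact hmax J hJ
  refine ⟨fun h => hcoeff (by rw [h, coeff_zero]), I, hI, ?_⟩
  exact m.toSyn.injective (le_antisymm hle (m.le_degree (mem_support_iff.2 hcoeff)))

/-- With `h = 0` this is what puts the relation read off from a subduction into the kernel. -/
theorem Subducts.aeval_eq {m : MonomialOrder σ} {b : ι → MvPolynomial σ F} {f h : MvPolynomial σ F}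
    {P : MvPolynomial ι F} (hs : Subducts m b f P h) : f = aeval b P + h := by
  induction hs with
  | refl f => simp
  | step f h P I c hf hlt hs ih => rw [map_add, add_assoc, ← ih]; ring

/-- The products subtracted in a subduction of `f` have lead monomials at most that of `f`. -/
theorem Subducts.leadExp_le {m : MonomialOrder σ} {b : ι → MvPolynomial σ F} (hb : ∀ i, b i ≠ 0)
    {f h : MvPolynomial σ F} {P : MvPolynomial ι F} (hs : Subducts m b f P h) :
    ∀ I ∈ P.support, m.toSyn (leadExp m b I) ≤ m.toSyn (m.degree f) := by
  classical
  induction hs with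
  | refl f => simp
  | step f h P J c hf hlt hs ih =>
    have hc : c ≠ 0 := by
      rintro rfl
      simp [m.leadingTerm_eq_zero_iff, hf] at hlt
    have hdeg : m.degree (aeval b (monomial J c)) = m.degree f := by
      rw [← m.degree_leadingTerm f, hlt, m.degree_leadingTerm]
    intro I hI
    rcases Finset.mem_union.1 (support_add hI) with h1 | h1
    · obtain rfl : I = J := by
        have := support_monomial_subset h1
        simpa using this
      rw [← degree_aeval_monomial m hb I hc, hdeg]
    · refine (ih I h1).trans (m.degree_sub_le.trans ?_)
      rw [hdeg, sup_idem]

theorem degree_sub_lt_of_leadingTerm_eq {m : MonomialOrder σ} {f g : MvPolynomial σ F}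
    (h : m.leadingTerm f = m.leadingTerm g) (hne : f - g ≠ 0) :
    m.toSyn (m.degree (f - g)) < m.toSyn (m.degree f) := by
  obtain ⟨hlc, hdeg⟩ := m.leadingTerm_eq_leadingTerm_iff.1 h
  refine lt_of_le_of_ne (m.degree_sub_le.trans (by rw [hdeg, sup_idem])) fun h' => ?_
  apply m.coeff_degree_ne_zero_iff.2 hne
  rw [coeff_sub, m.toSyn.injective h']
  nth_rewrite 2 [hdeg]
  exact sub_eq_zero.2 hlc

/-- If the lead monomial of every nonzero element of `A` is that of a product of the `b i`, then
every element of `A` subducts to zero. -/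
theorem exists_subducts_zero {m : MonomialOrder σ} {b : ι → MvPolynomial σ F} (hb : ∀ i, b i ≠ 0)
    {A : Subalgebra F (MvPolynomial σ F)} (hbA : ∀ i, b i ∈ A)
    (hA : ∀ f ∈ A, f ≠ 0 → ∃ I, m.degree f = leadExp m b I) (f : MvPolynomial σ F) (hf : f ∈ A) :
    ∃ P, Subducts m b f P 0 := by
  -- Well-founded induction on the lead exponent, which each step lowers.
  have key : ∀ s : m.syn, ∀ f ∈ A, m.toSyn (m.degree f) = s → ∃ P, Subducts m b f P 0 := by
    intro s
    induction s using WellFoundedLT.induction with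
    | ind s ih =>
      intro f hf hs
      by_cases h0 : f = 0
      · subst h0
        exact ⟨0, Subducts.refl 0⟩
      obtain ⟨I, hI⟩ := hA f hf h0
      set b1 := aeval b (monomial I (1 : F)) with hb1
      have hb1ne : b1 ≠ 0 := aeval_monomial_ne_zero hb I one_ne_zero
      have hlc : m.leadingCoeff b1 ≠ 0 := m.leadingCoeff_ne_zero_iff.2 hb1ne
      set c := m.leadingCoeff f / m.leadingCoeff b1 with hc
      have hcne : c ≠ 0 := div_ne_zero (m.leadingCoeff_ne_zero_iff.2 h0) hlc
      have hcb : aeval b (monomial I c) = C c * b1 := by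
        rw [hb1, aeval_monomial, aeval_monomial]
        simp [algebraMap_eq]
      have hlt : m.leadingTerm f = m.leadingTerm (aeval b (monomial I c)) := by
        rw [m.leadingTerm_eq_leadingTerm_iff]
        refine ⟨?_, by rw [degree_aeval_monomial m hb I hcne, hI]⟩
        rw [hcb, m.leadingCoeff_mul, m.leadingCoeff_C, hc, div_mul_cancel₀ _ hlc]
      have hmem : f - aeval b (monomial I c) ∈ A := by
        refine sub_mem hf ?_
        rw [aeval_monomial]
        exact mul_mem (A.algebraMap_mem c) (prod_mem fun i _ => pow_mem (hbA i) _)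
      have step : ∃ P, Subducts m b (f - aeval b (monomial I c)) P 0 := by
        by_cases hz : f - aeval b (monomial I c) = 0
        · rw [hz]
          exact ⟨0, Subducts.refl 0⟩
        refine ih _ ?_ _ hmem rfl
        rw [← hs]
        exact degree_sub_lt_of_leadingTerm_eq hlt hz
      obtain ⟨P, hP⟩ := step
      exact ⟨_, Subducts.step f 0 P I c h0 hlt hP⟩
  exact key _ f hf rfl

/-- A subset of `A` is a SAGBI basis if the lead monomials of the nonzero elements of `A` are those
of products of its members. -/
theorem isSagbiBasis_range {m : MonomialOrder σ} {b : ι → MvPolynomial σ F} (hb : ∀ i, b i ≠ 0)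
    {A : Subalgebra F (MvPolynomial σ F)} (hbA : ∀ i, b i ∈ A)
    (hA : ∀ f ∈ A, f ≠ 0 → ∃ I, m.degree f = leadExp m b I) :
    IsSagbiBasis m A (Set.range b) := by
  refine ⟨by rintro _ ⟨i, rfl⟩; exact hbA i, le_antisymm (Algebra.adjoin_le ?_)
    (Algebra.adjoin_le ?_)⟩
  · rintro _ ⟨_, ⟨i, rfl⟩, rfl⟩
    have hlc : m.leadingCoeff (b i) ≠ 0 := m.leadingCoeff_ne_zero_iff.2 (hb i)
    have h : leadMonomial m (b i) = (m.leadingCoeff (b i))⁻¹ • m.leadingTerm (b i) := by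
      rw [leadMonomial, MonomialOrder.leadingTerm, smul_monomial, smul_eq_mul, inv_mul_cancel₀ hlc]
    rw [h]
    exact Subalgebra.smul_mem _ (Algebra.subset_adjoin (Set.mem_image_of_mem _ (hbA i))) _
  · rintro _ ⟨f, hf, rfl⟩
    by_cases h0 : f = 0
    · rw [h0, m.leadingTerm_zero]
      exact zero_mem _
    obtain ⟨I, hI⟩ := hA f hf h0
    have h : m.leadingTerm f
        = m.leadingCoeff f • ∏ i ∈ I.support, leadMonomial m (b i) ^ I i := by
      have : ∏ i ∈ I.support, leadMonomial m (b i) ^ I i = monomial (leadExp m b I) (1 : F) := by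
        simp only [leadMonomial, monomial_pow, one_pow]
        rw [← monomial_sum_one, leadExp, Finsupp.linearCombination_apply, Finsupp.sum]
      rw [this, MonomialOrder.leadingTerm, hI, smul_monomial, smul_eq_mul, mul_one]
    rw [h]
    refine Subalgebra.smul_mem _ (Subalgebra.prod_mem _ fun i _ => pow_mem ?_ _) _
    exact Algebra.subset_adjoin (Set.mem_image_of_mem _ ⟨i, rfl⟩)

end Lead

/-! ### Translation invariants of a polynomial ring in one variable -/

section Translation

variable {R A : Type*} [CommRing R] [AddCommGroup A] [Fintype A]

/-- The orbit product of the variable under the translations by the `c a`. -/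
def normPoly (c : A →+ R) : Polynomial R := ∏ a, (Polynomial.X + Polynomial.C (c a))

theorem normPoly_monic (c : A →+ R) : (normPoly c).Monic :=
  Polynomial.monic_prod_of_monic _ _ fun a _ => Polynomial.monic_X_add_C (c a)

theorem natDegree_normPoly [Nontrivial R] (c : A →+ R) : (normPoly c).natDegree = Fintype.card A := by
  rw [normPoly, Polynomial.natDegree_prod_of_monic _ _ fun a _ => Polynomial.monic_X_add_C (c a)]
  simp

/-- Translation by `c a` permutes the factors. -/
theorem taylor_normPoly (c : A →+ R) (a : A) :
    Polynomial.taylor (c a) (normPoly c) = normPoly c := by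
  have h := map_prod (Polynomial.taylorAlgHom (c a))
    (fun b => Polynomial.X + Polynomial.C (c b)) Finset.univ
  simp only [Polynomial.taylorAlgHom_apply] at h
  rw [normPoly, h]
  refine Fintype.prod_equiv (Equiv.addLeft a) _ _ fun b => ?_
  simp [add_assoc]

/-- A polynomial invariant under finitely many translations is a polynomial in the orbit product
of the variable. -/
theorem exists_comp_normPoly [IsDomain R] {c : A →+ R} (hc : Function.Injective c) (H : Polynomial R)
    (hH : ∀ a, Polynomial.taylor (c a) H = H) :
    ∃ q : Polynomial R, H = q.comp (normPoly c) := by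
  have hmon := normPoly_monic c
  have hcard : 0 < Fintype.card A := Fintype.card_pos
  have hnd := natDegree_normPoly c
  induction hn : H.natDegree using Nat.strong_induction_on generalizing H with
  | _ n ih =>
    by_cases hlt : H.natDegree < Fintype.card A
    -- Invariance gives `H` the value `H(0)` at all the distinct points `c a`; there are more of
    -- them than the degree, so `H` is constant.
    · refine ⟨Polynomial.C (H.eval 0), ?_⟩
      rw [Polynomial.C_comp, ← sub_eq_zero]
      refine Polynomial.eq_zero_of_natDegree_lt_card_of_eval_eq_zero _ hc (fun a => ?_) ?_
      · have := congrArg (Polynomial.eval 0) (hH a)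
        rw [Polynomial.taylor_eval, zero_add] at this
        simp [this]
      · rwa [Polynomial.natDegree_sub_C]
    · have hdiv := Polynomial.modByMonic_add_div H (normPoly c)
      -- The divisor is invariant, so uniqueness of division with remainder makes quotient and
      -- remainder invariant.
      have hinv : ∀ a, Polynomial.taylor (c a) (H /ₘ normPoly c) = H /ₘ normPoly c ∧
          Polynomial.taylor (c a) (H %ₘ normPoly c) = H %ₘ normPoly c := by
        intro a
        have h := Polynomial.div_modByMonic_unique (f := H)
          (Polynomial.taylor (c a) (H /ₘ normPoly c)) (Polynomial.taylor (c a) (H %ₘ normPoly c))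
          hmon ⟨?_, ?_⟩
        · exact ⟨h.1.symm, h.2.symm⟩
        · conv_rhs => rw [← hH a, ← hdiv]
          rw [map_add, Polynomial.taylor_mul, taylor_normPoly]
        · rw [Polynomial.degree_taylor]
          exact Polynomial.degree_modByMonic_lt _ hmon
      have hdegq : (H /ₘ normPoly c).natDegree < n := by
        rw [Polynomial.natDegree_divByMonic _ hmon, hnd]
        omega
      obtain ⟨q, hq⟩ := ih _ hdegq _ (fun a => (hinv a).1) rfl
      have hne1 : normPoly c ≠ 1 := fun h => by
        rw [h, Polynomial.natDegree_one] at hnd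
        omega
      have hdegr : (H %ₘ normPoly c).natDegree < n := by
        have := Polynomial.natDegree_modByMonic_lt H hmon hne1
        omega
      obtain ⟨r, hr⟩ := ih _ hdegr _ (fun a => (hinv a).2) rfl
      refine ⟨r + Polynomial.X * q, ?_⟩
      rw [← hdiv, Polynomial.add_comp, Polynomial.mul_comp, Polynomial.X_comp, ← hq, ← hr]

end Translation

/-! ### Explicit forms of the generators -/

section Explicit

variable {F : Type*} [Field F]

/-- If a smaller power of x also cleared the denominator, `f` would be a positive power of x times a
polynomial. -/
theorem clearX_eq {g : FractionRing (MvPolynomial (Fin 3) F)} {f : MvPolynomial (Fin 3) F} {n : ℕ}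
    (hf : algebraMap _ (FractionRing (MvPolynomial (Fin 3) F)) f =
      algebraMap (MvPolynomial (Fin 3) F) (FractionRing (MvPolynomial (Fin 3) F)) (varX F) ^ n * g)
    (hx : ¬ varX F ∣ f) : clearX g = f := by
  classical
  have h : ∃ k : ℕ, ∃ f : MvPolynomial (Fin 3) F,
      algebraMap _ (FractionRing (MvPolynomial (Fin 3) F)) f =
      algebraMap (MvPolynomial (Fin 3) F) (FractionRing _) (varX F) ^ k * g := ⟨n, f, hf⟩
  have hinj := IsFractionRing.injective (MvPolynomial (Fin 3) F)
    (FractionRing (MvPolynomial (Fin 3) F))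
  rw [clearX, dif_pos h]
  have hs := (Nat.find_spec h).choose_spec
  set k := Nat.find h
  set f' := (Nat.find_spec h).choose
  have hk : k ≤ n := Nat.find_min' h ⟨f, hf⟩
  have hff : f = varX F ^ (n - k) * f' := by
    apply hinj
    rw [hf, map_mul, hs, map_pow, ← mul_assoc, ← pow_add, Nat.sub_add_cancel hk]
  rcases Nat.eq_zero_or_pos (n - k) with h0 | h0
  · rw [hff, h0, pow_zero, one_mul]
  · exact absurd (hff ▸ Dvd.dvd.mul_right (dvd_pow_self _ h0.ne') f') hx

theorem varX_ne_zero : varX F ≠ 0 := X_ne_zero 2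

theorem not_varX_dvd {f g : MvPolynomial (Fin 3) F} {c : F} (hc : c ≠ 0) {n : ℕ}
    (h : f = C c * varY F ^ n + varX F * g) : ¬ varX F ∣ f := by
  rintro ⟨k, hk⟩
  have h1 : C c * varY F ^ n = varX F * (k - g) := by rw [mul_sub, ← hk, h]; ring
  -- Evaluate at z = 0, y = 1, x = 0.
  have h2 := congrArg (aeval (![0, 1, 0] : Fin 3 → F)) h1
  simp [varX, varY] at h2
  exact hc h2

variable (p : ℕ) (M : Matrix (Fin 2) (Fin 2) F)

theorem gam_zero_one : gam p M ![0, 1] = M 0 0 * M 1 1 - M 0 1 * M 1 0 := by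
  rw [gam, Matrix.det_fin_two]
  simp [Gam]

theorem gam_zero_two : gam p M ![0, 2] = M 0 0 * M 0 1 ^ p - M 0 1 * M 0 0 ^ p := by
  rw [gam, Matrix.det_fin_two]
  simp [Gam]

theorem gam_one_two : gam p M ![1, 2] = M 1 0 * M 0 1 ^ p - M 1 1 * M 0 0 ^ p := by
  rw [gam, Matrix.det_fin_two]
  simp [Gam]

theorem gam_zero_three : gam p M ![0, 3] = M 0 0 * M 1 1 ^ p - M 0 1 * M 1 0 ^ p := by
  rw [gam, Matrix.det_fin_two]
  simp [Gam]

theorem gam_one_three : gam p M ![1, 3] = M 1 0 * M 1 1 ^ p - M 1 1 * M 1 0 ^ p := by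
  rw [gam, Matrix.det_fin_two]
  simp [Gam]

theorem fTilde_zero_one_two :
    let ι := algebraMap (MvPolynomial (Fin 3) F) (FractionRing (MvPolynomial (Fin 3) F))
    fTilde p M ![0, 1, 2] =
      ι (C (gam p M ![1, 2])) * (ι (varY F) / ι (varX F))
        + ι (C (gam p M ![0, 2])) * (ι (delta F) / ι (varX F) ^ 2)
        + ι (C (gam p M ![0, 1])) * (ι (varY F) / ι (varX F)) ^ p := by
  intro ι
  rw [gam_zero_one, gam_zero_two, gam_one_two]
  simp only [fTilde, GamTilde, vCol, Gam, Matrix.det_fin_three, Matrix.submatrix_apply, id,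
    Matrix.of_apply, Matrix.cons_val, Pi.pow_apply, map_sub, map_mul, map_pow]
  ring

theorem fTilde_zero_one_three (hp : Odd p) :
    let ι := algebraMap (MvPolynomial (Fin 3) F) (FractionRing (MvPolynomial (Fin 3) F))
    fTilde p M ![0, 1, 3] =
      ι (C (gam p M ![1, 3])) * (ι (varY F) / ι (varX F))
        + ι (C (gam p M ![0, 3])) * (ι (delta F) / ι (varX F) ^ 2)
        - ι (C (gam p M ![0, 1])) * (ι (delta F) / ι (varX F) ^ 2) ^ p := by
  intro ι
  rw [gam_zero_one, gam_zero_three, gam_one_three]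
  have h : (-ι (delta F) / ι (varX F) ^ 2) ^ p = -(ι (delta F) / ι (varX F) ^ 2) ^ p := by
    rw [neg_div, hp.neg_pow]
  simp only [fTilde, GamTilde, vCol, Gam, Matrix.det_fin_three, Matrix.submatrix_apply, id,
    Matrix.of_apply, Matrix.cons_val, Pi.pow_apply, map_sub, map_mul, map_pow]
  rw [h]
  ring

/-- The part of `f₁` divisible by `x`, divided by `x`. -/
def fOneTail : MvPolynomial (Fin 3) F :=
  varX F ^ (p - 3) * (C (gam p M ![0, 2]) * delta F + C (gam p M ![1, 2]) * varY F * varX F)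

/-- The part of `f₂` divisible by `x`, divided by `x`. -/
def fTwoTail : MvPolynomial (Fin 3) F :=
  C (gam p M ![0, 1] * gam p M ![1, 2]) * varY F ^ (p + 1)
    - C (gam p M ![0, 1] * gam p M ![0, 2]) * varY F ^ p * varZ F
    + C (2⁻¹ : F) * (C (gam p M ![0, 1] ^ 2) * varX F * varZ F ^ p
      + varX F ^ (p - 3) *
        (C (gam p M ![0, 2]) * delta F + C (gam p M ![1, 2]) * varY F * varX F) ^ 2
      + varX F ^ (p - 1) * (C (gam p M ![0, 1] * gam p M ![0, 3]) * delta F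
        + C (gam p M ![0, 1] * gam p M ![1, 3]) * varY F * varX F))

variable {p M}

/-- The deepest pole along x is that of (y/x)^p, of order p > 2, and its coefficient γ₁₂ is nonzero;
so the minimal exponent is p. -/
theorem fOne_eq (hp : 2 < p) (h01 : gam p M ![0, 1] ≠ 0) :
    fOne p M = C (gam p M ![0, 1]) * varY F ^ p + varX F * fOneTail p M := by
  refine clearX_eq (n := p) ?_ (not_varX_dvd h01 rfl)
  have hx : algebraMap _ (FractionRing (MvPolynomial (Fin 3) F)) (varX F) ≠ 0 := by
    simpa using varX_ne_zero
  rw [fTilde_zero_one_two, fOneTail]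
  simp only [map_add, map_mul, map_pow]
  obtain ⟨n, hn⟩ := Nat.exists_eq_add_of_lt hp
  obtain rfl : p = n + 3 := by omega
  rw [Nat.add_sub_cancel]
  simp only [div_pow]
  field_simp
  ring

/-- Here the deepest pole is that of (δ/x²)^p, so the minimal exponent is 2p. -/
theorem fMinor_zero_one_three_eq [Fact p.Prime] (hp : 2 < p) (h01 : gam p M ![0, 1] ≠ 0) :
    fMinor p M ![0, 1, 3] = -(C (gam p M ![0, 1]) * delta F ^ p)
      + varX F ^ (2 * p - 2) *
        (C (gam p M ![0, 3]) * delta F + C (gam p M ![1, 3]) * varY F * varX F) := by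
  have hodd : Odd p := (Fact.out : p.Prime).odd_of_ne_two (by omega)
  have hx : algebraMap _ (FractionRing (MvPolynomial (Fin 3) F)) (varX F) ≠ 0 := by
    simpa using varX_ne_zero
  refine clearX_eq (n := 2 * p) ?_ ?_
  · rw [fTilde_zero_one_three p M hodd]
    simp only [map_add, map_mul, map_pow, map_neg]
    obtain ⟨n, hn⟩ := Nat.exists_eq_add_of_lt hp
    obtain rfl : p = n + 3 := by omega
    rw [show 2 * (n + 3) - 2 = 2 * n + 4 by omega]
    simp only [div_pow]
    field_simp
    ring
  · rintro ⟨k, hk⟩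
    have h2 := congrArg (aeval (![0, 1, 0] : Fin 3 → F)) hk
    have h0 : 2 * p - 2 ≠ 0 := by omega
    simp [varX, varY, varZ, delta, h0] at h2
    exact h01 h2

variable [Fact p.Prime] [Algebra (ZMod p) F]

theorem charP_of_algebra_zmod (p : ℕ) [Fact p.Prime] (F : Type*) [Field F] [Algebra (ZMod p) F] :
    CharP F p :=
  charP_of_injective_algebraMap (algebraMap (ZMod p) F).injective p

theorem two_ne_zero_of_lt (hp : 2 < p) : (2 : F) ≠ 0 := by
  have := charP_of_algebra_zmod p F
  intro h
  have h1 := (CharP.cast_eq_zero_iff F p 2).1 (by exact_mod_cast h)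
  exact absurd (Nat.le_of_dvd (by norm_num) h1) (by omega)

/-- By Frobenius δ^p = y^{2p} - x^p z^p, so the terms γ₁₂²y^{2p} of the two summands cancel. The
cross term of f₁² supplies the lowest remaining power x^{p-2}, with coefficient 2γ₁₂γ₁₃y^{p+2}
modulo x. -/
theorem numerator_eq (hp : 2 < p) (h01 : gam p M ![0, 1] ≠ 0) :
    C (gam p M ![0, 1]) * fMinor p M ![0, 1, 3] + fOne p M ^ 2 =
      varX F ^ (p - 2) * (2 * (C (gam p M ![0, 1] * gam p M ![0, 2]) * varY F ^ (p + 2)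
        + varX F * fTwoTail p M)) := by
  have := charP_of_algebra_zmod p F
  have h2 : (2 : MvPolynomial (Fin 3) F) * C (2⁻¹ : F) = 1 := by
    rw [show (2 : MvPolynomial (Fin 3) F) = C 2 from (map_ofNat C 2).symm, ← C_mul,
      mul_inv_cancel₀ (two_ne_zero_of_lt hp), C_1]
  have hd : delta F ^ p = varY F ^ (2 * p) - varX F ^ p * varZ F ^ p := by
    rw [delta, sub_pow_char, mul_pow, ← pow_mul]
  rw [fMinor_zero_one_three_eq hp h01, fOne_eq hp h01, hd, fTwoTail, fOneTail, delta]
  obtain ⟨n, hn⟩ := Nat.exists_eq_add_of_lt hp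
  obtain rfl : p = n + 3 := by omega
  rw [show 2 * (n + 3) - 2 = 2 * n + 4 by omega, show n + 3 - 3 = n by omega,
    show n + 3 - 2 = n + 1 by omega, show n + 3 - 1 = n + 2 by omega]
  simp only [C_mul, C_pow]
  linear_combination (-(varX F ^ (n + 2) * (C (gam (n + 3) M ![0, 1]) ^ 2 * varX F * varZ F ^ (n + 3)
      + varX F ^ n *
        (C (gam (n + 3) M ![0, 2]) * (varY F ^ 2 - varX F * varZ F)
          + C (gam (n + 3) M ![1, 2]) * varY F * varX F) ^ 2
      + varX F ^ (n + 2) * (C (gam (n + 3) M ![0, 1]) * C (gam (n + 3) M ![0, 3])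
          * (varY F ^ 2 - varX F * varZ F)
        + C (gam (n + 3) M ![0, 1]) * C (gam (n + 3) M ![1, 3]) * varY F * varX F)))) * h2

theorem fTwo_eq (hp : 2 < p) (h01 : gam p M ![0, 1] ≠ 0) :
    fTwo p M = C (gam p M ![0, 1] * gam p M ![0, 2]) * varY F ^ (p + 2)
        + varX F * fTwoTail p M := by
  have h2 : C (2⁻¹ : F) * (2 : MvPolynomial (Fin 3) F) = 1 := by
    rw [show (2 : MvPolynomial (Fin 3) F) = C 2 from (map_ofNat C 2).symm, ← C_mul,
      inv_mul_cancel₀ (two_ne_zero_of_lt hp), C_1]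
  rw [fTwo, numerator_eq hp h01, varX, X_pow_eq_monomial, divMonomial_monomial_mul, ← mul_assoc,
    h2, one_mul]

theorem two_mul_fTwo (hp : 2 < p) (h01 : gam p M ![0, 1] ≠ 0) :
    2 * varX F ^ (p - 2) * fTwo p M =
      C (gam p M ![0, 1]) * fMinor p M ![0, 1, 3] + fOne p M ^ 2 := by
  rw [numerator_eq hp h01, fTwo_eq hp h01]
  ring

end Explicit

/-! ### The action of the group -/

section Action

variable (p : ℕ) {F : Type*} [Field F] [Algebra (ZMod p) F]

/-- The homomorphism `(ℤ/p)² → F` taking the basis to the entries of `v`. -/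
def shift (v : Fin 2 → F) : (Fin 2 → ZMod p) →+ F where
  toFun a := ∑ j, a j • v j
  map_zero' := by simp
  map_add' a b := by simp [add_smul]; ring

theorem shift_apply (v : Fin 2 → F) (a : Fin 2 → ZMod p) :
    shift p v a = algebraMap (ZMod p) F (a 0) * v 0 + algebraMap (ZMod p) F (a 1) * v 1 := by
  simp [shift, Fin.sum_univ_two, Algebra.smul_def]

variable (M : Matrix (Fin 2) (Fin 2) F)

/-- The action of an element of `(ℤ/p)²`, written additively, on `F[z, y, x]`. -/
def act (a : Fin 2 → ZMod p) : MvPolynomial (Fin 3) F →ₐ[F] MvPolynomial (Fin 3) F :=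
  polyAct (repHom p M (Multiplicative.ofAdd a)).val

theorem repHom_val (a : Fin 2 → ZMod p) : (repHom p M (Multiplicative.ofAdd a)).val =
    sigmaMat (shift p (M 0) a) (shift p (M 1) a) := rfl

variable {p M}

@[simp] theorem act_varX (a : Fin 2 → ZMod p) : act p M a (varX F) = varX F := by
  simp [act, repHom_val, polyAct, sigmaMat, varX, Fin.sum_univ_three]

@[simp] theorem act_varY (a : Fin 2 → ZMod p) :
    act p M a (varY F) = varY F + C (shift p (M 0) a) * varX F := by
  simp [act, repHom_val, polyAct, sigmaMat, varX, varY, Fin.sum_univ_three]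

@[simp] theorem act_varZ (a : Fin 2 → ZMod p) :
    act p M a (varZ F) = varZ F + C (2 * shift p (M 0) a) * varY F
      + C (shift p (M 0) a ^ 2 + shift p (M 1) a) * varX F := by
  simp [act, repHom_val, polyAct, sigmaMat, varX, varY, varZ, Fin.sum_univ_three]

@[simp] theorem act_C (a : Fin 2 → ZMod p) (c : F) : act p M a (C c) = C c :=
  (act p M a).commutes c

@[simp] theorem act_delta (a : Fin 2 → ZMod p) :
    act p M a (delta F) = delta F - C (shift p (M 1) a) * varX F ^ 2 := by
  have h2 : (C 2 : MvPolynomial (Fin 3) F) = 2 := map_ofNat C 2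
  simp only [delta, map_sub, map_mul, map_pow, act_varX, act_varY, act_varZ, C_add, h2]
  ring

theorem act_act (a b : Fin 2 → ZMod p) (f : MvPolynomial (Fin 3) F) :
    act p M a (act p M b f) = act p M (a + b) f := by
  have h : (act p M a).comp (act p M b) = act p M (a + b) := algHom_ext fun i => ?_
  · exact DFunLike.congr_fun h f
  fin_cases i
  · change act p M a (act p M b (varZ F)) = act p M (a + b) (varZ F)
    simp only [map_add, map_mul, map_pow, map_ofNat, act_varX, act_varY, act_varZ, act_C]
    ring
  · change act p M a (act p M b (varY F)) = act p M (a + b) (varY F)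
    simp only [map_add, map_mul, act_varX, act_varY, act_C]
    ring
  · change act p M a (act p M b (varX F)) = act p M (a + b) (varX F)
    simp only [act_varX]

theorem mem_invariants {f : MvPolynomial (Fin 3) F} :
    f ∈ invariants p M ↔ ∀ a, act p M a f = f := by
  simp only [invariants, Algebra.mem_iInf, AlgHom.mem_equalizer, AlgHom.id_apply]
  exact ⟨fun h a => h (Multiplicative.ofAdd a), fun h a => h a.toAdd⟩

theorem C_mem_invariants (c : F) : C c ∈ invariants p M := (invariants p M).algebraMap_mem c

theorem varX_mem_invariants : varX F ∈ invariants p M := mem_invariants.2 act_varX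

variable [Fact p.Prime]

/-- Frobenius is additive and fixes the coefficients in `ZMod p`. -/
theorem shift_pow (v : Fin 2 → F) (a : Fin 2 → ZMod p) :
    shift p v a ^ p = shift p (v ^ p) a := by
  have := charP_of_algebra_zmod p F
  rw [shift_apply, shift_apply, add_pow_char, mul_pow, mul_pow, ← map_pow, ← map_pow,
    ZMod.pow_card, ZMod.pow_card, Pi.pow_apply, Pi.pow_apply]

/-- A zero of the shift also kills its p-th power; together these are two linear equations for `a`
with determinant γ₁₃. -/
theorem shift_injective (h : gam p M ![0, 2] ≠ 0) : Function.Injective (shift p (M 0)) := by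
  rw [injective_iff_map_eq_zero]
  intro a ha
  have hp0 : p ≠ 0 := (Fact.out : p.Prime).ne_zero
  have hb := congrArg (· ^ p) ha
  simp only [shift_pow, zero_pow hp0] at hb
  rw [shift_apply] at ha hb
  simp only [Pi.pow_apply] at hb
  rw [gam_zero_two] at h
  have h0 : algebraMap (ZMod p) F (a 0) * (M 0 0 * M 0 1 ^ p - M 0 1 * M 0 0 ^ p) = 0 := by
    linear_combination M 0 1 ^ p * ha - M 0 1 * hb
  have h1 : algebraMap (ZMod p) F (a 1) * (M 0 0 * M 0 1 ^ p - M 0 1 * M 0 0 ^ p) = 0 := by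
    linear_combination M 0 0 * hb - M 0 0 ^ p * ha
  have h0 := (mul_eq_zero.1 h0).resolve_right h
  have h1 := (mul_eq_zero.1 h1).resolve_right h
  rw [map_eq_zero] at h0 h1
  ext i
  fin_cases i
  · exact h0
  · exact h1

/-- Expand the minor on the first three rows of Γ augmented by the column Γa, which depends on the
columns of Γ. This is the change of the minor defining f₁ under the action, since y/x and -δ/x² are
translated by the two shifts. -/
theorem shift_relation (a : Fin 2 → ZMod p) :
    gam p M ![0, 1] * shift p (M 0) a ^ p - gam p M ![0, 2] * shift p (M 1) a
      + gam p M ![1, 2] * shift p (M 0) a = 0 := by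
  rw [shift_pow, shift_apply, shift_apply, shift_apply, gam_zero_one, gam_zero_two, gam_one_two]
  simp only [Pi.pow_apply]
  ring

theorem shift_relation' (a : Fin 2 → ZMod p) :
    gam p M ![0, 1] * shift p (M 1) a ^ p - gam p M ![0, 3] * shift p (M 1) a
      + gam p M ![1, 3] * shift p (M 0) a = 0 := by
  rw [shift_pow, shift_apply, shift_apply, shift_apply, gam_zero_one, gam_zero_three, gam_one_three]
  simp only [Pi.pow_apply]
  ring

theorem act_fOne (hp : 2 < p) (h01 : gam p M ![0, 1] ≠ 0) (a : Fin 2 → ZMod p) :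
    act p M a (fOne p M) = fOne p M := by
  have := charP_of_algebra_zmod p F
  have hrel := congrArg (C (σ := Fin 3)) (shift_relation (M := M) a)
  have hx : varX F ^ p = varX F * varX F ^ (p - 3) * varX F ^ 2 := by
    rw [← pow_succ', ← pow_add]
    congr 1
    omega
  simp only [C_add, C_mul, C_sub, C_pow, C_0] at hrel
  rw [fOne_eq hp h01, fOneTail]
  simp only [map_add, map_mul, map_pow, act_varX, act_varY, act_C, act_delta]
  rw [add_pow_char, mul_pow, hx]
  linear_combination (varX F * varX F ^ (p - 3) * varX F ^ 2) * hrel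

theorem act_fMinor (hp : 2 < p) (h01 : gam p M ![0, 1] ≠ 0) (a : Fin 2 → ZMod p) :
    act p M a (fMinor p M ![0, 1, 3]) = fMinor p M ![0, 1, 3] := by
  have := charP_of_algebra_zmod p F
  have hrel := congrArg (C (σ := Fin 3)) (shift_relation' (M := M) a)
  have hx : (varX F ^ 2) ^ p = varX F ^ (2 * p - 2) * varX F ^ 2 := by
    rw [← pow_mul, ← pow_add]
    congr 1
    omega
  simp only [C_add, C_mul, C_sub, C_pow, C_0] at hrel
  rw [fMinor_zero_one_three_eq hp h01]
  simp only [map_add, map_mul, map_pow, map_neg, act_varX, act_varY, act_C, act_delta]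
  rw [sub_pow_char, mul_pow, hx]
  linear_combination (varX F ^ (2 * p - 2) * varX F ^ 2) * hrel

/-- The multiple 2x^{p-2}f₂ is invariant, and the invariant factor 2x^{p-2} can be cancelled. -/
theorem act_fTwo (hp : 2 < p) (h01 : gam p M ![0, 1] ≠ 0) (a : Fin 2 → ZMod p) :
    act p M a (fTwo p M) = fTwo p M := by
  have h2 : (2 : MvPolynomial (Fin 3) F) ≠ 0 := by
    rw [show (2 : MvPolynomial (Fin 3) F) = C 2 from (map_ofNat C 2).symm]
    exact C_ne_zero.2 (two_ne_zero_of_lt hp)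
  have h := congrArg (act p M a) (two_mul_fTwo (M := M) hp h01)
  simp only [map_add, map_mul, map_pow, act_varX, act_C, act_fMinor hp h01, act_fOne hp h01,
    map_ofNat] at h
  rw [← two_mul_fTwo hp h01] at h
  exact mul_left_cancel₀ (mul_ne_zero h2 (pow_ne_zero _ varX_ne_zero)) h

/-- The conjugates of z already differ in their y-coefficients, so the orbit has p² elements and its
product may be taken over the group. -/
theorem act_varZ_injective (hp : 2 < p) (h02 : gam p M ![0, 2] ≠ 0) :
    Function.Injective fun a => act p M a (varZ F) := by
  intro a b h
  apply shift_injective h02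
  simp only [act_varZ] at h
  have h1 := congrArg (aeval (![0, 1, 0] : Fin 3 → F)) h
  simp [varX, varY, varZ] at h1
  exact h1.resolve_right (two_ne_zero_of_lt hp)

theorem orbitNorm_varZ (hp : 2 < p) (h02 : gam p M ![0, 2] ≠ 0) :
    orbitNorm p M (varZ F) = ∏ a, act p M a (varZ F) := by
  classical
  rw [orbitNorm, Finset.prod_image]
  · exact Fintype.prod_equiv Multiplicative.toAdd _ _ fun _ => rfl
  · intro a _ b _ h
    exact act_varZ_injective hp h02 h

theorem act_orbitNorm (hp : 2 < p) (h02 : gam p M ![0, 2] ≠ 0) (a : Fin 2 → ZMod p) :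
    act p M a (orbitNorm p M (varZ F)) = orbitNorm p M (varZ F) := by
  rw [orbitNorm_varZ hp h02, map_prod]
  exact Fintype.prod_equiv (Equiv.addLeft a) _ _ fun b => act_act a b _

theorem gens_mem_invariants (hp : 2 < p) (h01 : gam p M ![0, 1] ≠ 0) (h02 : gam p M ![0, 2] ≠ 0)
    (i : Fin 4) : gens p M i ∈ invariants p M := by
  rw [mem_invariants]
  intro a
  fin_cases i
  · exact act_varX a
  · exact act_fOne hp h01 a
  · exact act_fTwo hp h01 a
  · exact act_orbitNorm hp h02 a

end Action

/-! ### Coordinates `x, f₁, y` after inverting `x` -/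

section Coordinates

variable (p : ℕ) {F : Type*} [Field F] (M : Matrix (Fin 2) (Fin 2) F)

/-- The homomorphism `F[T₀, T₁][Y] → F[z, y, x]` with `T₀ ↦ x`, `T₁ ↦ f₁`, `Y ↦ y`. -/
def coordHom : Polynomial (MvPolynomial (Fin 2) F) →+* MvPolynomial (Fin 3) F :=
  Polynomial.eval₂RingHom (aeval (R := F) ![varX F, fOne p M]).toRingHom (varY F)

@[simp] theorem coordHom_X : coordHom p M Polynomial.X = varY F := by simp [coordHom]

@[simp] theorem coordHom_C (c : MvPolynomial (Fin 2) F) :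
    coordHom p M (Polynomial.C c) = aeval (R := F) ![varX F, fOne p M] c := by simp [coordHom]

/-- The polynomial in `T₀, T₁, Y` representing `γ₁₃ x^{p-1} z`. -/
def zPoly : Polynomial (MvPolynomial (Fin 2) F) :=
  Polynomial.C (C (gam p M ![0, 1])) * Polynomial.X ^ p
    + (Polynomial.C (C (gam p M ![0, 2]) * X 0 ^ (p - 2)) * Polynomial.X ^ 2
      + Polynomial.C (C (gam p M ![1, 2]) * X 0 ^ (p - 1)) * Polynomial.X
      - Polynomial.C (X 1))

/-- The polynomial in `T₀, T₁, Y` representing `γ₁₃ x^{p-2} δ`. -/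
def deltaPoly : Polynomial (MvPolynomial (Fin 2) F) :=
  Polynomial.C (-C (gam p M ![0, 1])) * Polynomial.X ^ p
    + (Polynomial.C (-C (gam p M ![1, 2]) * X 0 ^ (p - 1)) * Polynomial.X + Polynomial.C (X 1))

/-- The polynomial in `T₀, T₁, Y` representing `γ₁₃^p x^{p(p-2)} f₁₂₄`. -/
def fMinorPoly : Polynomial (MvPolynomial (Fin 2) F) :=
  Polynomial.C (-C (gam p M ![0, 1])) * deltaPoly p M ^ p
    + (Polynomial.C (C (gam p M ![0, 2] ^ (p - 1) * gam p M ![0, 3])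
        * X 0 ^ ((p - 2) * (p - 1) + (2 * p - 2))) * deltaPoly p M
      + Polynomial.C (C (gam p M ![0, 2] ^ p * gam p M ![1, 3])
        * X 0 ^ ((p - 2) * p + (2 * p - 2) + 1)) * Polynomial.X)

variable {p M}

/-- Solve the explicit formula for f₁, which is linear in z. -/
theorem coordHom_zPoly (hp : 2 < p) (h01 : gam p M ![0, 1] ≠ 0) :
    coordHom p M (zPoly p M) = C (gam p M ![0, 2]) * varX F ^ (p - 1) * varZ F := by
  have h : fOne p M = C (gam p M ![0, 1]) * varY F ^ p + varX F * fOneTail p M := fOne_eq hp h01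
  obtain ⟨n, rfl⟩ : ∃ n, p = n + 3 := ⟨p - 3, by omega⟩
  rw [fOneTail, delta, show n + 3 - 3 = n by omega] at h
  rw [zPoly, show n + 3 - 2 = n + 1 by omega, show n + 3 - 1 = n + 2 by omega]
  simp only [map_add, map_sub, map_mul, map_pow, coordHom_X, coordHom_C, aeval_X, aeval_C,
    algebraMap_eq, Matrix.cons_val_zero, Matrix.cons_val_one]
  rw [h]
  ring

theorem coordHom_deltaPoly (hp : 2 < p) (h01 : gam p M ![0, 1] ≠ 0) :
    coordHom p M (deltaPoly p M) = C (gam p M ![0, 2]) * varX F ^ (p - 2) * delta F := by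
  have h : fOne p M = C (gam p M ![0, 1]) * varY F ^ p + varX F * fOneTail p M := fOne_eq hp h01
  obtain ⟨n, rfl⟩ : ∃ n, p = n + 3 := ⟨p - 3, by omega⟩
  rw [fOneTail, show n + 3 - 3 = n by omega] at h
  rw [deltaPoly, show n + 3 - 2 = n + 1 by omega, show n + 3 - 1 = n + 2 by omega]
  simp only [map_add, map_neg, map_mul, map_pow, coordHom_X, coordHom_C, aeval_X, aeval_C,
    algebraMap_eq, Matrix.cons_val_zero, Matrix.cons_val_one]
  rw [h]
  ring

theorem coordHom_fMinorPoly [Fact p.Prime] (hp : 2 < p) (h01 : gam p M ![0, 1] ≠ 0) :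
    coordHom p M (fMinorPoly p M) =
      C (gam p M ![0, 2] ^ p) * varX F ^ ((p - 2) * p) * fMinor p M ![0, 1, 3] := by
  have hd := coordHom_deltaPoly hp h01
  rw [fMinor_zero_one_three_eq hp h01, fMinorPoly]
  simp only [map_add, map_neg, map_mul, map_pow, coordHom_X, coordHom_C, aeval_X, aeval_C,
    algebraMap_eq, Matrix.cons_val_zero, hd]
  have h1 : C (gam p M ![0, 2]) ^ p = C (gam p M ![0, 2]) ^ (p - 1) * C (σ := Fin 3)
      (gam p M ![0, 2]) := by
    rw [← pow_succ]
    congr 1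
    omega
  have h2 : varX F ^ ((p - 2) * p) = varX F ^ ((p - 2) * (p - 1)) * varX F ^ (p - 2) := by
    rw [← pow_add, ← Nat.mul_succ]
    congr 2
    omega
  rw [mul_pow, mul_pow, ← pow_mul, pow_add, pow_add, pow_add, h2, h1]
  ring

/-- The map `Λ` inverts `coordHom` over the fraction field by sending z to `zPoly` divided by
γ₁₃T₀^{p-1}; the composite is the embedding into the fraction field. -/
theorem coordHom_injective (hp : 2 < p) (h01 : gam p M ![0, 1] ≠ 0)
    (h02 : gam p M ![0, 2] ≠ 0) : Function.Injective (coordHom p M) := by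
  let ι := algebraMap (Polynomial (MvPolynomial (Fin 2) F))
    (FractionRing (Polynomial (MvPolynomial (Fin 2) F)))
  have hι : Function.Injective ι := IsFractionRing.injective _ _
  let d : Polynomial (MvPolynomial (Fin 2) F) :=
    Polynomial.C (C (gam p M ![0, 2]) * X 0 ^ (p - 1))
  have hd : ι d ≠ 0 := by
    rw [map_ne_zero_iff ι hι]
    exact Polynomial.C_ne_zero.2 (mul_ne_zero (C_ne_zero.2 h02) (pow_ne_zero _ (X_ne_zero 0)))
  let Λ : MvPolynomial (Fin 3) F →+* FractionRing (Polynomial (MvPolynomial (Fin 2) F)) :=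
    eval₂Hom (ι.comp (Polynomial.C.comp C))
      ![ι (zPoly p M) / ι d, ι Polynomial.X, ι (Polynomial.C (X 0))]
  have hC : ∀ c, Λ (C c) = ι (Polynomial.C (C c)) := fun c => by simp [Λ]
  have hx : Λ (varX F) = ι (Polynomial.C (X 0)) := by simp [Λ, varX]
  have hy : Λ (varY F) = ι Polynomial.X := by simp [Λ, varY]
  have hz : Λ (varZ F) = ι (zPoly p M) / ι d := by simp [Λ, varZ]
  -- Apply `Λ` to the identity defining `zPoly`, where T₁ occurs linearly.
  have hf : Λ (fOne p M) = ι (Polynomial.C (X 1)) := by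
    have h1 := congrArg Λ (coordHom_zPoly (M := M) hp h01)
    have h2 : Λ (C (gam p M ![0, 2]) * varX F ^ (p - 1) * varZ F) = ι (zPoly p M) := by
      rw [map_mul, hz, map_mul, map_pow, hC, hx, ← map_pow, ← map_mul, ← Polynomial.C_pow,
        ← Polynomial.C_mul, mul_div_cancel₀ _ hd]
    rw [h2] at h1
    simp only [zPoly, map_add, map_sub, map_mul, map_pow, coordHom_X, coordHom_C, aeval_X, aeval_C,
      algebraMap_eq, Matrix.cons_val_zero, Matrix.cons_val_one, hx, hy, hC] at h1
    linear_combination -h1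
  have hcomp : Λ.comp (coordHom p M) = ι := by
    refine Polynomial.ringHom_ext' (MvPolynomial.ringHom_ext (fun c => ?_) fun i => ?_) ?_
    · simp [hC, algebraMap_eq]
    · fin_cases i
      · simp [hx]
      · simp [hf]
    · simp [hy]
  intro H H' h
  apply hι
  rw [← hcomp, RingHom.comp_apply, h, RingHom.comp_apply]

/-- Surjectivity of `coordHom` once γ₁₃x^{p-1} is inverted. -/
theorem exists_coordHom_eq (hp : 2 < p) (h01 : gam p M ![0, 1] ≠ 0) (h : MvPolynomial (Fin 3) F) :
    ∃ (k : ℕ) (H : Polynomial (MvPolynomial (Fin 2) F)),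
      (C (gam p M ![0, 2]) * varX F ^ (p - 1)) ^ k * h = coordHom p M H := by
  induction h using MvPolynomial.induction_on with
  | C a => exact ⟨0, Polynomial.C (C a), by simp [algebraMap_eq]⟩
  | add f g hf hg =>
    obtain ⟨k, H, hH⟩ := hf
    obtain ⟨l, K, hK⟩ := hg
    obtain ⟨D, hD⟩ : ∃ D, coordHom p M D = C (gam p M ![0, 2]) * varX F ^ (p - 1) :=
      ⟨Polynomial.C (C (gam p M ![0, 2]) * X 0 ^ (p - 1)), by simp [algebraMap_eq]⟩
    refine ⟨k + l, D ^ l * H + D ^ k * K, ?_⟩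
    rw [map_add, map_mul, map_mul, map_pow, map_pow, hD, ← hH, ← hK]
    ring
  | mul_X f i hf =>
    obtain ⟨k, H, hH⟩ := hf
    fin_cases i
    · refine ⟨k + 1, H * zPoly p M, ?_⟩
      rw [map_mul, coordHom_zPoly hp h01, ← hH]
      change _ * (f * varZ F) = _
      ring
    · refine ⟨k, H * Polynomial.X, ?_⟩
      rw [map_mul, coordHom_X, ← hH]
      exact (mul_assoc _ _ _).symm
    · refine ⟨k, H * Polynomial.C (X 0), ?_⟩
      rw [map_mul, coordHom_C, ← hH, aeval_X]
      exact (mul_assoc _ _ _).symm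

theorem zPoly_degree (hp : 2 < p) (h01 : gam p M ![0, 1] ≠ 0) :
    (zPoly p M).natDegree = p ∧ (zPoly p M).leadingCoeff = C (gam p M ![0, 1]) := by
  have hlt : (Polynomial.C (C (gam p M ![0, 2]) * X 0 ^ (p - 2)) * Polynomial.X ^ 2
      + Polynomial.C (C (gam p M ![1, 2]) * X 0 ^ (p - 1)) * Polynomial.X
      - Polynomial.C (X 1) : Polynomial (MvPolynomial (Fin 2) F)).natDegree <
      (Polynomial.C (C (gam p M ![0, 1])) * Polynomial.X ^ p :
        Polynomial (MvPolynomial (Fin 2) F)).natDegree := by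
    rw [Polynomial.natDegree_C_mul_X_pow _ _ (C_ne_zero.2 h01)]
    exact lt_of_le_of_lt (by compute_degree) hp
  constructor
  · rw [zPoly, Polynomial.natDegree_add_eq_left_of_natDegree_lt hlt,
      Polynomial.natDegree_C_mul_X_pow _ _ (C_ne_zero.2 h01)]
  · rw [zPoly, Polynomial.leadingCoeff_add_of_degree_lt' (Polynomial.degree_lt_degree hlt),
      Polynomial.leadingCoeff_C_mul_X_pow]

theorem deltaPoly_degree (hp : 2 < p) (h01 : gam p M ![0, 1] ≠ 0) :
    (deltaPoly p M).natDegree = p ∧ (deltaPoly p M).leadingCoeff = -C (gam p M ![0, 1]) := by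
  have hlt : (Polynomial.C (-C (gam p M ![1, 2]) * X 0 ^ (p - 1)) * Polynomial.X
      + Polynomial.C (X 1) : Polynomial (MvPolynomial (Fin 2) F)).natDegree <
      (Polynomial.C (-C (gam p M ![0, 1])) * Polynomial.X ^ p :
        Polynomial (MvPolynomial (Fin 2) F)).natDegree := by
    rw [Polynomial.natDegree_C_mul_X_pow _ _ (neg_ne_zero.2 (C_ne_zero.2 h01))]
    exact lt_of_le_of_lt (b := 1) (by compute_degree) (by omega)
  constructor
  · rw [deltaPoly, Polynomial.natDegree_add_eq_left_of_natDegree_lt hlt,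
      Polynomial.natDegree_C_mul_X_pow _ _ (neg_ne_zero.2 (C_ne_zero.2 h01))]
  · rw [deltaPoly, Polynomial.leadingCoeff_add_of_degree_lt' (Polynomial.degree_lt_degree hlt),
      Polynomial.leadingCoeff_C_mul_X_pow]

/-- The leading coefficient in Y is a nonzero scalar, free of T₀ and T₁; this later makes N(y)
expressible through f₁₂₄ without denominators. -/
theorem fMinorPoly_degree (hp : 2 < p) (h01 : gam p M ![0, 1] ≠ 0) :
    (fMinorPoly p M).natDegree = p * p ∧
      (fMinorPoly p M).leadingCoeff = -C (gam p M ![0, 1]) * (-C (gam p M ![0, 1])) ^ p := by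
  have hne : -C (gam p M ![0, 1]) ≠ (0 : MvPolynomial (Fin 2) F) := neg_ne_zero.2 (C_ne_zero.2 h01)
  obtain ⟨hdeg, hlc⟩ := deltaPoly_degree hp h01
  have hdeg1 : (Polynomial.C (-C (gam p M ![0, 1])) * deltaPoly p M ^ p).natDegree = p * p := by
    rw [Polynomial.natDegree_C_mul hne, Polynomial.natDegree_pow, hdeg]
  have hlt : (Polynomial.C (C (gam p M ![0, 2] ^ (p - 1) * gam p M ![0, 3])
        * X 0 ^ ((p - 2) * (p - 1) + (2 * p - 2))) * deltaPoly p M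
      + Polynomial.C (C (gam p M ![0, 2] ^ p * gam p M ![1, 3])
        * X 0 ^ ((p - 2) * p + (2 * p - 2) + 1)) * Polynomial.X).natDegree <
      (Polynomial.C (-C (gam p M ![0, 1])) * deltaPoly p M ^ p).natDegree := by
    rw [hdeg1]
    refine lt_of_le_of_lt (b := p) ?_ (by nlinarith)
    refine Polynomial.natDegree_add_le_of_degree_le ?_ ?_
    · exact (Polynomial.natDegree_C_mul_le _ _).trans hdeg.le
    · exact (Polynomial.natDegree_C_mul_le _ _).trans (Polynomial.natDegree_X_le.trans (by omega))
  constructor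
  · rw [fMinorPoly, Polynomial.natDegree_add_eq_left_of_natDegree_lt hlt, hdeg1]
  · rw [fMinorPoly, Polynomial.leadingCoeff_add_of_degree_lt' (Polynomial.degree_lt_degree hlt),
      Polynomial.leadingCoeff_mul, Polynomial.leadingCoeff_C, Polynomial.leadingCoeff_pow, hlc]

variable [Algebra (ZMod p) F]

variable (p M) in
/-- The translation of `Y` corresponding to the action on `y`. -/
def shiftHom : (Fin 2 → ZMod p) →+ MvPolynomial (Fin 2) F :=
  (AddMonoidHom.mulRight (X 0)).comp (C.toAddMonoidHom.comp (shift p (M 0)))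

theorem shiftHom_apply (a : Fin 2 → ZMod p) : shiftHom p M a = C (shift p (M 0) a) * X 0 := rfl

variable [Fact p.Prime]

theorem shiftHom_injective (h02 : gam p M ![0, 2] ≠ 0) : Function.Injective (shiftHom p M) := by
  intro a b h
  exact shift_injective h02 (C_injective _ _ (mul_right_cancel₀ (X_ne_zero 0) h))

/-- The group fixes x and f₁, so in these coordinates it only translates Y. -/
theorem act_coordHom (hp : 2 < p) (h01 : gam p M ![0, 1] ≠ 0) (a : Fin 2 → ZMod p)
    (H : Polynomial (MvPolynomial (Fin 2) F)) :
    act p M a (coordHom p M H) = coordHom p M (Polynomial.taylor (shiftHom p M a) H) := by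
  have h : (act p M a).toRingHom.comp (coordHom p M) =
      (coordHom p M).comp (Polynomial.taylorAlgHom (shiftHom p M a)).toRingHom := by
    refine Polynomial.ringHom_ext' (MvPolynomial.ringHom_ext (fun c => ?_) fun i => ?_) ?_
    · simp [algebraMap_eq]
    · fin_cases i
      · simp
      · simp [act_fOne hp h01]
    · simp [shiftHom_apply, algebraMap_eq]
  exact DFunLike.congr_fun h H

theorem exists_comp_of_coordHom_mem (hp : 2 < p) (h01 : gam p M ![0, 1] ≠ 0)
    (h02 : gam p M ![0, 2] ≠ 0) {H : Polynomial (MvPolynomial (Fin 2) F)}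
    (hH : coordHom p M H ∈ invariants p M) :
    ∃ q : Polynomial (MvPolynomial (Fin 2) F), H = q.comp (normPoly (shiftHom p M)) := by
  refine exists_comp_normPoly (shiftHom_injective h02) H fun a => ?_
  apply coordHom_injective hp h01 h02
  rw [← act_coordHom hp h01, mem_invariants.1 hH a]

end Coordinates

/-! ### Lead monomials of the generators -/

section LeadMonomials

variable {F : Type*} [Field F]

/-- Among monomials of equal degree, grevlex puts those divisible by the smallest variable x below
y^n. -/
theorem degree_of_isHomogeneous {f g : MvPolynomial (Fin 3) F} {c : F} {n : ℕ} (hc : c ≠ 0)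
    (hn : n ≠ 0) (hg : (varX F * g).IsHomogeneous n) (h : f = C c * varY F ^ n + varX F * g) :
    grevlex.degree f = Finsupp.single 1 n := by
  classical
  have h1 : grevlex.degree (C c * varY F ^ n) = Finsupp.single 1 n := by
    rw [varY, C_mul_X_pow_eq_monomial, grevlex.degree_monomial, if_neg hc]
  rw [h, grevlex.degree_add_of_lt, h1]
  rw [h1, grevlex.degree_lt_iff]
  · intro J hJ
    rw [grevlex_lt_iff]
    have hJ' := mem_support_iff.1 hJ
    have hdeg : J.degree = n := by
      rw [Finsupp.degree_eq_weight_one]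
      exact hg hJ'
    have h2 : J 2 ≠ 0 := by
      rw [varX, coeff_X_mul'] at hJ'
      intro h0
      simp [h0] at hJ'
    refine Or.inr ⟨by simp [hdeg], Or.inl ?_⟩
    simp
    omega
  · rw [grevlex_lt_iff]
    left
    simp
    omega

theorem leadingCoeff_of_isHomogeneous {f g : MvPolynomial (Fin 3) F} {c : F} {n : ℕ} (hc : c ≠ 0)
    (hn : n ≠ 0) (hg : (varX F * g).IsHomogeneous n) (h : f = C c * varY F ^ n + varX F * g) :
    grevlex.leadingCoeff f = c := by
  classical
  rw [MonomialOrder.leadingCoeff, degree_of_isHomogeneous hc hn hg h, h, varX, varY,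
    C_mul_X_pow_eq_monomial, coeff_add, coeff_monomial, coeff_X_mul']
  simp

theorem isHomogeneous_delta : (delta F).IsHomogeneous 2 :=
  ((isHomogeneous_X F 1).pow 2).sub ((isHomogeneous_X F 2).mul (isHomogeneous_X F 0))

theorem isHomogeneous_linComb (a b : F) :
    (C a * delta F + C b * varY F * varX F).IsHomogeneous 2 := by
  refine IsHomogeneous.add ?_ ?_
  · simpa using (isHomogeneous_C (Fin 3) a).mul (isHomogeneous_delta (F := F))
  · simpa [varX, varY] using
      ((isHomogeneous_C (Fin 3) b).mul (isHomogeneous_X F 1)).mul (isHomogeneous_X F 2)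

variable {p : ℕ} {M : Matrix (Fin 2) (Fin 2) F}

theorem isHomogeneous_fOneTail (hp : 2 < p) : (varX F * fOneTail p M).IsHomogeneous p := by
  have h := (isHomogeneous_X F (2 : Fin 3)).mul
    (((isHomogeneous_X F (2 : Fin 3)).pow (p - 3)).mul
      (isHomogeneous_linComb (gam p M ![0, 2]) (gam p M ![1, 2])))
  rwa [show 1 + (1 * (p - 3) + 2) = p by omega] at h

theorem isHomogeneous_fTwoTail (hp : 2 < p) : (varX F * fTwoTail p M).IsHomogeneous (p + 2) := by
  have hx : (varX F).IsHomogeneous 1 := isHomogeneous_X F (2 : Fin 3)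
  have hy : (varY F).IsHomogeneous 1 := isHomogeneous_X F (1 : Fin 3)
  have hz : (varZ F).IsHomogeneous 1 := isHomogeneous_X F (0 : Fin 3)
  have hC := fun a : F => isHomogeneous_C (Fin 3) a
  have h : (fTwoTail p M).IsHomogeneous (p + 1) := by
    refine IsHomogeneous.add (IsHomogeneous.sub ?_ ?_) ?_
    · have := (hC (gam p M ![0, 1] * gam p M ![1, 2])).mul (hy.pow (p + 1))
      rwa [show 0 + 1 * (p + 1) = p + 1 by omega] at this
    · have := ((hC (gam p M ![0, 1] * gam p M ![0, 2])).mul (hy.pow p)).mul hz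
      rwa [show 0 + 1 * p + 1 = p + 1 by omega] at this
    · rw [← zero_add (p + 1)]
      refine (hC (2⁻¹ : F)).mul (IsHomogeneous.add (IsHomogeneous.add ?_ ?_) ?_)
      · have := ((hC (gam p M ![0, 1] ^ 2)).mul hx).mul (hz.pow p)
        rwa [show 0 + 1 + 1 * p = p + 1 by omega] at this
      · have := (hx.pow (p - 3)).mul
          ((isHomogeneous_linComb (gam p M ![0, 2]) (gam p M ![1, 2])).pow 2)
        rwa [show 1 * (p - 3) + 2 * 2 = p + 1 by omega] at this
      · have := (hx.pow (p - 1)).mul (isHomogeneous_linComb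
          (gam p M ![0, 1] * gam p M ![0, 3]) (gam p M ![0, 1] * gam p M ![1, 3]))
        rwa [show 1 * (p - 1) + 2 = p + 1 by omega] at this
  have := hx.mul h
  rwa [show 1 + (p + 1) = p + 2 by omega] at this

theorem degree_linearForm (a b : F) :
    grevlex.degree (varZ F + C a * varY F + C b * varX F) = Finsupp.single 0 1 := by
  classical
  have hz : grevlex.degree (varZ F) = Finsupp.single 0 1 := grevlex.degree_X
  have hlt : grevlex.toSyn (grevlex.degree (C a * varY F + C b * varX F)) <
      grevlex.toSyn (grevlex.degree (varZ F)) := by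
    rw [hz]
    refine lt_of_le_of_lt grevlex.degree_add_le (max_lt ?_ ?_)
    · rw [varY, C_mul_X_eq_monomial]
      refine lt_of_le_of_lt (grevlex.degree_monomial_le a) ?_
      rw [grevlex_lt_iff]
      simp
    · rw [varX, C_mul_X_eq_monomial]
      refine lt_of_le_of_lt (grevlex.degree_monomial_le b) ?_
      rw [grevlex_lt_iff]
      simp
  rw [add_assoc, grevlex.degree_add_of_lt hlt, hz]

theorem linearForm_ne_zero (a b : F) : varZ F + C a * varY F + C b * varX F ≠ 0 := by
  apply grevlex.ne_zero_of_degree_ne_zero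
  rw [degree_linearForm]
  simp

theorem degree_prod_linearForm {ι : Type*} [Fintype ι] (a b : ι → F) :
    grevlex.degree (∏ i, (varZ F + C (a i) * varY F + C (b i) * varX F)) =
      Finsupp.single 0 (Fintype.card ι) := by
  rw [grevlex.degree_prod fun i _ => linearForm_ne_zero (a i) (b i)]
  simp [degree_linearForm]

/-- A family with the lead exponents of
`x, y ^ p, y ^ (p + 2), z ^ (p ^ 2)`. -/
structure HasGensLead (p : ℕ) (b : Fin 4 → MvPolynomial (Fin 3) F) : Prop where
  zero : grevlex.degree (b 0) = Finsupp.single 2 1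
  one : grevlex.degree (b 1) = Finsupp.single 1 p
  two : grevlex.degree (b 2) = Finsupp.single 1 (p + 2)
  three : grevlex.degree (b 3) = Finsupp.single 0 (p ^ 2)

namespace HasGensLead

variable {b : Fin 4 → MvPolynomial (Fin 3) F}

theorem ne_zero (hb : HasGensLead p b) (hp : p ≠ 0) (i : Fin 4) : b i ≠ 0 := by
  apply grevlex.ne_zero_of_degree_ne_zero
  fin_cases i
  · simp [hb.zero]
  · simp [hb.one, hp]
  · simp [hb.two]
  · simp [hb.three, hp]

theorem leadExp_eq (hb : HasGensLead p b) (I : Fin 4 →₀ ℕ) :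
    leadExp grevlex b I 0 = p ^ 2 * I 3 ∧ leadExp grevlex b I 1 = p * I 1 + (p + 2) * I 2 ∧
      leadExp grevlex b I 2 = I 0 := by
  have h : leadExp grevlex b I = ∑ i, I i • grevlex.degree (b i) := by
    rw [leadExp, Finsupp.linearCombination_apply, Finsupp.sum_fintype]
    simp
  rw [h, Fin.sum_univ_four, hb.zero, hb.one, hb.two, hb.three]
  simp [mul_comm]
  ring

theorem degree_leadExp (hb : HasGensLead p b) (I : Fin 4 →₀ ℕ) :
    (leadExp grevlex b I).degree = I 0 + p * I 1 + (p + 2) * I 2 + p ^ 2 * I 3 := by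
  obtain ⟨h0, h1, h2⟩ := hb.leadExp_eq I
  rw [Finsupp.degree_eq_sum, Fin.sum_univ_three, h0, h1, h2]
  ring

/-- The exponents of x and z give `I 0` and `I 3`. The exponent of y modulo p gives 2 · `I 2`, hence
`I 2` because p is odd and `I 2 < p`; then `I 1` follows. -/
theorem injOn (hb : HasGensLead p b) [Fact p.Prime] (hp : 2 < p) :
    Set.InjOn (leadExp grevlex b) {I | I 2 < p} := by
  intro I hI J hJ h
  obtain ⟨h0, h1, h2⟩ := hb.leadExp_eq I
  obtain ⟨k0, k1, k2⟩ := hb.leadExp_eq J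
  rw [h] at h0 h1 h2
  have e3 : I 3 = J 3 := Nat.eq_of_mul_eq_mul_left (by positivity) (h0.symm.trans k0)
  have e0 : I 0 = J 0 := h2.symm.trans k2
  have e : p * I 1 + (p + 2) * I 2 = p * J 1 + (p + 2) * J 2 := h1.symm.trans k1
  have hmod : 2 * I 2 ≡ 2 * J 2 [MOD p] := by
    have h1 : p * (I 1 + I 2) + 2 * I 2 = p * (J 1 + J 2) + 2 * J 2 := by linarith
    have := congrArg (· % p) h1
    simpa [Nat.ModEq] using this
  have hcop : Nat.gcd p 2 = 1 :=
    (Nat.coprime_primes Fact.out Nat.prime_two).2 (by omega)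
  have e2 : I 2 = J 2 :=
    Nat.ModEq.eq_of_lt_of_lt (Nat.ModEq.cancel_left_of_coprime hcop hmod) hI hJ
  have e1 : I 1 = J 1 := by
    rw [e2] at e
    exact Nat.eq_of_mul_eq_mul_left (by positivity) (Nat.add_right_cancel e)
  ext i
  fin_cases i
  · exact e0
  · exact e1
  · exact e2
  · exact e3

/-- A polynomial of degree less than `p` in `T₂` does not vanish at a family with the lead
exponents of the generators. -/
theorem aeval_ne_zero (hb : HasGensLead p b) [Fact p.Prime] (hp : 2 < p)
    {r : MvPolynomial (Fin 4) F} (hr : r ≠ 0) (hdeg : degreeOf 2 r < p) :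
    aeval b r ≠ 0 ∧ ∃ I ∈ r.support, grevlex.degree (aeval b r) = leadExp grevlex b I := by
  refine aeval_ne_zero_of_injOn grevlex (hb.ne_zero (by omega)) hr ?_
  refine (hb.injOn hp).mono fun I hI => ?_
  exact lt_of_le_of_lt (monomial_le_degreeOf 2 hI) hdeg

end HasGensLead

variable [Fact p.Prime] [Algebra (ZMod p) F]

theorem hasGensLead_gens (hp : 2 < p) (h01 : gam p M ![0, 1] ≠ 0) (h02 : gam p M ![0, 2] ≠ 0) :
    HasGensLead p (gens p M) where
  zero := grevlex.degree_X
  one := degree_of_isHomogeneous h01 (by omega) (isHomogeneous_fOneTail hp) (fOne_eq hp h01)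
  two := degree_of_isHomogeneous (mul_ne_zero h01 h02) (by omega) (isHomogeneous_fTwoTail hp)
    (fTwo_eq hp h01)
  three := by
    change grevlex.degree (orbitNorm p M (varZ F)) = _
    rw [orbitNorm_varZ hp h02]
    simp only [act_varZ]
    rw [degree_prod_linearForm]
    simp [ZMod.card]

/-- Reduction modulo `x`. -/
def modX : MvPolynomial (Fin 3) F →ₐ[F] MvPolynomial (Fin 3) F := aeval ![varZ F, varY F, 0]

@[simp] theorem modX_varX : modX (varX F) = 0 := by simp [modX, varX]

@[simp] theorem modX_varY : modX (varY F) = varY F := by simp [modX, varY]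

@[simp] theorem modX_varZ : modX (varZ F) = varZ F := by simp [modX, varZ]

@[simp] theorem modX_C (c : F) : modX (C c) = C c := by simp [modX, algebraMap_eq]

/-- Reduction modulo x keeps the lead monomials of the last three generators. Slot `0` keeps x
rather than its reduction 0, which is harmless for polynomials free of T₀. -/
theorem hasGensLead_modX (hp : 2 < p) (h01 : gam p M ![0, 1] ≠ 0) (h02 : gam p M ![0, 2] ≠ 0) :
    HasGensLead p ![varX F, modX (fOne p M), modX (fTwo p M),
      modX (orbitNorm p M (varZ F))] where
  zero := grevlex.degree_X
  one := by
    refine degree_of_isHomogeneous (g := 0) h01 (by omega) ?_ ?_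
    · rw [mul_zero]
      exact isHomogeneous_zero _ _ _
    · simp [fOne_eq hp h01]
  two := by
    refine degree_of_isHomogeneous (g := 0) (mul_ne_zero h01 h02) (by omega) ?_ ?_
    · rw [mul_zero]
      exact isHomogeneous_zero _ _ _
    · simp [fTwo_eq hp h01]
  three := by
    change grevlex.degree (modX (orbitNorm p M (varZ F))) = _
    rw [orbitNorm_varZ hp h02, map_prod]
    have h : ∀ a, modX (act p M a (varZ F)) =
        varZ F + C (2 * shift p (M 0) a) * varY F + C 0 * varX F := fun a => by
      rw [act_varZ]
      simp only [map_add, map_mul, modX_varX, modX_varY, modX_varZ, modX_C, mul_zero, C_0, zero_mul]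
    simp only [h]
    rw [degree_prod_linearForm]
    simp [ZMod.card]

/-- If the value at the generators of a polynomial of degree less than `p` in `T₂` is divisible by
`x`, then the polynomial is divisible by `T₀`. -/
theorem X_zero_dvd_of_varX_dvd (hp : 2 < p) (h01 : gam p M ![0, 1] ≠ 0) (h02 : gam p M ![0, 2] ≠ 0)
    {r : MvPolynomial (Fin 4) F} (hdeg : degreeOf 2 r < p) (hr : varX F ∣ aeval (gens p M) r) :
    X 0 ∣ r := by
  rw [X_dvd_iff_modMonomial_eq_zero]
  by_contra hne
  have hdec := divMonomial_add_modMonomial_single r 0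
  -- `s` is the part of `r` free of T₀. If nonzero, its value modulo x would be nonzero, against the
  -- divisibility by x.
  set s := r.modMonomial (Finsupp.single 0 1) with hs
  have hsupp : ∀ I ∈ s.support, I ∈ r.support ∧ I 0 = 0 := by
    intro I hI
    rw [mem_support_iff] at hI
    have hle : ¬ Finsupp.single 0 1 ≤ I := fun hle => hI (coeff_modMonomial_of_le r hle)
    rw [hs, coeff_modMonomial_of_not_le r hle] at hI
    refine ⟨mem_support_iff.2 hI, ?_⟩
    rw [Finsupp.single_le_iff] at hle
    omega
  have hsdeg : degreeOf 2 s < p := by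
    rw [degreeOf_lt_iff (by omega)] at hdeg ⊢
    exact fun I hI => hdeg I (hsupp I hI).1
  refine ((hasGensLead_modX hp h01 h02).aeval_ne_zero hp hne hsdeg).1 ?_
  have h1 : modX (aeval (gens p M) s) = 0 := by
    obtain ⟨t, ht⟩ := hr
    have h2 := congrArg (fun f => modX (aeval (gens p M) f)) hdec
    simp only [map_add, map_mul, ht, modX_varX, zero_mul, aeval_X] at h2
    have h3 : modX (gens p M 0) = 0 := modX_varX
    rwa [h3, zero_mul, zero_add] at h2
  rw [← h1]
  -- The two families differ only in slot `0`, whose variable does not occur in `s`.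
  refine hom_congr_vars (f₁ := (aeval (R := F) _).toRingHom)
    (f₂ := (modX.comp (aeval (gens p M))).toRingHom) ?_ ?_ rfl
  · ext c
    simp
  · intro i hi _
    rw [mem_vars_iff_mem_support] at hi
    obtain ⟨I, hI, hi⟩ := hi
    fin_cases i
    · exact absurd (hsupp I hI).2 (Finsupp.mem_support_iff.1 hi)
    · simp [gens]
    · simp [gens]
    · simp [gens]

end LeadMonomials

/-! ### The relation between the generators -/

section Relation

variable {p : ℕ} [Fact p.Prime] {F : Type*} [Field F] [Algebra (ZMod p) F]
  {M : Matrix (Fin 2) (Fin 2) F}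

theorem aeval_gens_rename (c : MvPolynomial (Fin 2) F) :
    aeval (gens p M) (rename ![(0 : Fin 4), 1] c) = aeval (R := F) ![varX F, fOne p M] c := by
  rw [aeval_rename]
  congr 2
  ext i
  fin_cases i <;> rfl

theorem aeval_gens_C (c : F) : aeval (gens p M) (C c) = C c := aeval_C _ _

theorem aeval_gens_X_zero : aeval (gens p M) (X 0 : MvPolynomial (Fin 4) F) = varX F := aeval_X _ _

theorem aeval_gens_X_one : aeval (gens p M) (X 1 : MvPolynomial (Fin 4) F) = fOne p M := aeval_X _ _

theorem aeval_gens_X_two : aeval (gens p M) (X 2 : MvPolynomial (Fin 4) F) = fTwo p M := aeval_X _ _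

theorem aeval_gens_X_three : aeval (gens p M) (X 3 : MvPolynomial (Fin 4) F) = orbitNorm p M (varZ F) := aeval_X _ _

theorem natDegree_normPoly_shiftHom : (normPoly (shiftHom p M)).natDegree = p * p := by
  rw [natDegree_normPoly]
  simp [ZMod.card, pow_two]

theorem fMinor_mem_invariants (hp : 2 < p) (h01 : gam p M ![0, 1] ≠ 0) :
    fMinor p M ![0, 1, 3] ∈ invariants p M :=
  mem_invariants.2 (act_fMinor hp h01)

theorem C_mul_inv_cancel {σ : Type*} {a : F} (ha : a ≠ 0) :
    (C a * C a⁻¹ : MvPolynomial σ F) = 1 := by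
  rw [← C_mul, mul_inv_cancel₀ ha, C_1]

/-- The orbit product of `y` is linear in `f₂` with coefficients in `F[x, f₁]`. -/
theorem exists_coordHom_normPoly_eq (hp : 2 < p) (h01 : gam p M ![0, 1] ≠ 0)
    (h02 : gam p M ![0, 2] ≠ 0) :
    ∃ (α : F) (e : ℕ) (b : MvPolynomial (Fin 2) F), α ≠ 0 ∧
      coordHom p M (normPoly (shiftHom p M)) =
        aeval (gens p M) (C α * X 0 ^ e * X 2 + rename ![0, 1] b) := by
  have hpp : 0 < p * p := by positivity
  have hmem : coordHom p M (fMinorPoly p M) ∈ invariants p M := by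
    rw [coordHom_fMinorPoly hp h01]
    exact mul_mem (mul_mem (C_mem_invariants _) (pow_mem varX_mem_invariants _))
      (fMinor_mem_invariants hp h01)
  obtain ⟨q, hq⟩ := exists_comp_of_coordHom_mem hp h01 h02 hmem
  obtain ⟨hdeg, hlc⟩ := fMinorPoly_degree (M := M) hp h01
  -- Both `fMinorPoly` and the orbit product of Y have degree p² in Y.
  have hq1 : q.natDegree = 1 := by
    rw [hq, Polynomial.natDegree_comp, natDegree_normPoly_shiftHom] at hdeg
    exact Nat.eq_of_mul_eq_mul_right hpp (by rw [hdeg, one_mul])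
  rw [hq, Polynomial.leadingCoeff_comp (by rw [natDegree_normPoly_shiftHom]; exact hpp.ne'),
    (normPoly_monic _).leadingCoeff, one_pow, mul_one] at hlc
  set g := gam p M ![0, 1] with hg
  set a : F := -g * (-g) ^ p with ha
  have hane : a ≠ 0 := mul_ne_zero (neg_ne_zero.2 h01) (pow_ne_zero _ (neg_ne_zero.2 h01))
  have hqa : q = Polynomial.C (C a) * Polynomial.X + Polynomial.C (q.coeff 0) := by
    conv_lhs => rw [Polynomial.eq_X_add_C_of_natDegree_le_one hq1.le]
    rw [← hq1, Polynomial.coeff_natDegree, hlc]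
    simp [ha]
  have key := coordHom_fMinorPoly (M := M) hp h01
  rw [hq, hqa, Polynomial.add_comp, Polynomial.mul_comp, Polynomial.C_comp, Polynomial.X_comp,
    Polynomial.C_comp, map_add, map_mul, coordHom_C, coordHom_C, aeval_C, algebraMap_eq] at key
  have h2 := two_mul_fTwo (M := M) hp h01
  rw [← hg] at h2
  set n := coordHom p M (normPoly (shiftHom p M))
  set h := gam p M ![0, 2]
  have hga : g * a ≠ 0 := mul_ne_zero h01 hane
  -- Eliminate f₁₂₄ between γ₁₃^p x^{(p-2)p} f₁₂₄ = aN(y) + q₀ and γ₁₂f₁₂₄ = 2x^{p-2}f₂ - f₁², then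
  -- solve for N(y).
  refine ⟨(g * a)⁻¹ * (2 * h ^ p), (p - 2) * p + (p - 2),
    C (g * a)⁻¹ * (-(C (h ^ p) * X 0 ^ ((p - 2) * p) * X 1 ^ 2) - C g * q.coeff 0),
    mul_ne_zero (inv_ne_zero hga) (mul_ne_zero (two_ne_zero_of_lt hp) (pow_ne_zero _ h02)), ?_⟩
  rw [map_add, aeval_gens_rename]
  have hg0 : gens p M 0 = varX F := rfl
  have hg2 : gens p M 2 = fTwo p M := rfl
  simp only [map_mul, map_sub, map_neg, map_pow, hg0, hg2, aeval_X, aeval_C, algebraMap_eq, Matrix.cons_val_zero, Matrix.cons_val_one, map_ofNat]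
  simp only [map_pow] at key
  have hinv := C_mul_inv_cancel (σ := Fin 3) hga
  simp only [C_mul] at hinv
  refine mul_left_cancel₀ (C_ne_zero.2 hga) ?_
  rw [pow_add, C_mul]
  linear_combination C g * key - C h ^ p * varX F ^ ((p - 2) * p) * h2 -
    (C h ^ p * varX F ^ ((p - 2) * p) * (2 * varX F ^ (p - 2) * fTwo p M - fOne p M ^ 2)
      - C g * aeval ![varX F, fOne p M] (q.coeff 0)) * hinv

theorem degreeOf_two_rename (c : MvPolynomial (Fin 2) F) :
    degreeOf 2 (rename ![(0 : Fin 4), 1] c) = 0 := by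
  classical
  rw [degreeOf_def, Multiset.count_eq_zero]
  intro h
  have h2 := vars_rename ![(0 : Fin 4), 1] c (by rwa [vars_def, Multiset.mem_toFinset])
  rw [Finset.mem_image] at h2
  obtain ⟨i, -, hi⟩ := h2
  fin_cases i <;> simp at hi

theorem degreeOf_eval₂_le {ι : Type*} (i : ι) {R : Type*} [CommRing R]
    {φ : R →+* MvPolynomial ι F} (hφ : ∀ c, degreeOf i (φ c) = 0) {L : MvPolynomial ι F}
    (hL : degreeOf i L ≤ 1) (q : Polynomial R) :
    degreeOf i (q.eval₂ φ L) ≤ q.natDegree := by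
  rw [Polynomial.eval₂_eq_sum_range]
  refine (degreeOf_sum_le i _ _).trans (Finset.sup_le fun k hk => ?_)
  refine (degreeOf_mul_le i _ _).trans ?_
  rw [hφ, zero_add]
  refine (degreeOf_pow_le i L k).trans ?_
  have := Finset.mem_range.1 hk
  calc k * degreeOf i L ≤ k * 1 := Nat.mul_le_mul_left k hL
    _ ≤ q.natDegree := by omega

/-- Each translate of `zPoly` represents γ₁₃x^{p-1} times a conjugate of z. -/
theorem coordHom_prod_taylor (hp : 2 < p) (h01 : gam p M ![0, 1] ≠ 0)
    (h02 : gam p M ![0, 2] ≠ 0) :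
    coordHom p M (∏ a, Polynomial.taylor (shiftHom p M a) (zPoly p M)) =
      (C (gam p M ![0, 2]) * varX F ^ (p - 1)) ^ (p ^ 2) * orbitNorm p M (varZ F) := by
  have h : ∀ a, coordHom p M (Polynomial.taylor (shiftHom p M a) (zPoly p M)) =
      C (gam p M ![0, 2]) * varX F ^ (p - 1) * act p M a (varZ F) := fun a => by
    rw [← act_coordHom hp h01, coordHom_zPoly hp h01, map_mul, map_mul, map_pow, act_C, act_varX]
  rw [map_prod, orbitNorm_varZ hp h02]
  simp only [h]
  rw [Finset.prod_mul_distrib, Finset.prod_const]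
  simp [ZMod.card]

/-- A relation of degree `p` in `T₂`, with lead coefficient a multiple of a power of `T₀`. -/
theorem exists_relation (hp : 2 < p) (h01 : gam p M ![0, 1] ≠ 0) (h02 : gam p M ![0, 2] ≠ 0) :
    ∃ (i : ℕ) (c : F) (r : MvPolynomial (Fin 4) F), c ≠ 0 ∧ degreeOf 2 r < p ∧
      aeval (gens p M) (C c * X 0 ^ i * X 2 ^ p + r) = 0 := by
  have := charP_of_algebra_zmod p F
  have hpp : 0 < p * p := by positivity
  obtain ⟨α, e, b, hα, hn⟩ := exists_coordHom_normPoly_eq hp h01 h02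
  have hprod := coordHom_prod_taylor hp h01 h02
  set H := ∏ a, Polynomial.taylor (shiftHom p M a) (zPoly p M) with hH
  obtain ⟨zdeg, zlc⟩ := zPoly_degree (M := M) hp h01
  have hzne : zPoly p M ≠ 0 := fun h => by
    rw [h, Polynomial.natDegree_zero] at zdeg
    omega
  have hcard : Fintype.card (Fin 2 → ZMod p) = p * p := by simp [ZMod.card, pow_two]
  have hHdeg : H.natDegree = p * (p * p) := by
    rw [hH, Polynomial.natDegree_prod]
    · simp only [Polynomial.natDegree_taylor, zdeg, Finset.sum_const, Finset.card_univ, hcard,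
        smul_eq_mul]
      ring
    · intro a _
      rwa [Ne, Polynomial.taylor_eq_zero]
  have hHlc : H.leadingCoeff = C (gam p M ![0, 1] ^ (p * p)) := by
    rw [hH, Polynomial.leadingCoeff_prod]
    simp only [Polynomial.leadingCoeff_taylor, zlc, Finset.prod_const, Finset.card_univ, hcard,
      C_pow]
  have hmem : coordHom p M H ∈ invariants p M := by
    rw [hprod]
    exact mul_mem (pow_mem (mul_mem (C_mem_invariants _) (pow_mem varX_mem_invariants _)) _)
      (gens_mem_invariants hp h01 h02 3)
  obtain ⟨q, hq⟩ := exists_comp_of_coordHom_mem hp h01 h02 hmem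
  -- The product has p² factors of degree p in Y, and N(y) has degree p².
  have hqdeg : q.natDegree = p := by
    rw [hq, Polynomial.natDegree_comp, natDegree_normPoly_shiftHom] at hHdeg
    exact Nat.eq_of_mul_eq_mul_right hpp hHdeg
  rw [hq, Polynomial.leadingCoeff_comp (by rw [natDegree_normPoly_shiftHom]; exact hpp.ne'),
    (normPoly_monic _).leadingCoeff, one_pow, mul_one] at hHlc
  set L : MvPolynomial (Fin 4) F := C α * X 0 ^ e * X 2 + rename ![0, 1] b with hL
  let φ : MvPolynomial (Fin 2) F →+* MvPolynomial (Fin 4) F :=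
    (rename (R := F) ![(0 : Fin 4), 1]).toRingHom
  have hφ : ∀ c, degreeOf 2 (φ c) = 0 := degreeOf_two_rename
  have hLdeg : degreeOf 2 L ≤ 1 := by
    refine (degreeOf_add_le 2 _ _).trans (max_le ?_ ?_)
    · refine (degreeOf_mul_le 2 _ _).trans ?_
      have h1 : degreeOf (2 : Fin 4) (C α * X 0 ^ e : MvPolynomial (Fin 4) F) = 0 := by
        refine Nat.le_zero.1 ((degreeOf_C_mul_le _ _ _).trans ?_)
        rw [degreeOf_X_pow_of_ne e (by decide)]
      rw [h1, degreeOf_X_self]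
    · rw [degreeOf_two_rename]
      exact Nat.zero_le _
  have hval : ∀ s : Polynomial (MvPolynomial (Fin 2) F),
      aeval (gens p M) (s.eval₂ φ L) = coordHom p M (s.comp (normPoly (shiftHom p M))) := by
    intro s
    induction s using Polynomial.induction_on' with
    | add s t hs ht => rw [Polynomial.eval₂_add, map_add, hs, ht, Polynomial.add_comp, map_add]
    | monomial k c =>
      rw [Polynomial.eval₂_monomial, Polynomial.monomial_comp, map_mul, map_mul, map_pow, map_pow,
        hn, coordHom_C]
      congr 1
      exact aeval_gens_rename c
  have hsplit : q = Polynomial.C (C (gam p M ![0, 1] ^ (p * p))) * Polynomial.X ^ p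
      + q.eraseLead := by
    conv_lhs => rw [← q.eraseLead_add_C_mul_X_pow]
    rw [hHlc, hqdeg, add_comm]
  -- Frobenius leaves no intermediate powers of T₂, so outside the term in T₂^p everything has
  -- T₂-degree below p.
  have hLp : L ^ p = C (α ^ p) * X 0 ^ (e * p) * X 2 ^ p + rename ![0, 1] (b ^ p) := by
    rw [hL, add_pow_char, mul_pow, mul_pow, ← pow_mul, ← C_pow, map_pow (rename _)]
  refine ⟨e * p, gam p M ![0, 1] ^ (p * p) * α ^ p,
    C (gam p M ![0, 1] ^ (p * p)) * rename ![0, 1] (b ^ p) + q.eraseLead.eval₂ φ L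
      - (C (gam p M ![0, 2]) * X 0 ^ (p - 1)) ^ (p ^ 2) * X 3,
    mul_ne_zero (pow_ne_zero _ h01) (pow_ne_zero _ hα), ?_, ?_⟩
  · refine lt_of_le_of_lt (degreeOf_sub_le 2 _ _) (max_lt (lt_of_le_of_lt (degreeOf_add_le 2 _ _)
      (max_lt ?_ ?_)) ?_)
    · refine lt_of_le_of_lt (degreeOf_C_mul_le _ _ _) ?_
      rw [degreeOf_two_rename]
      omega
    · refine lt_of_le_of_lt (degreeOf_eval₂_le 2 hφ hLdeg _) ?_
      have := q.eraseLead_natDegree_le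
      omega
    · rw [degreeOf_mul_X_of_ne _ (by decide), mul_pow, ← C_pow, ← pow_mul]
      refine lt_of_le_of_lt (degreeOf_C_mul_le _ _ _) ?_
      rw [degreeOf_X_pow_of_ne _ (by decide)]
      omega
  · have h1 := hval q
    rw [← hq, hprod] at h1
    have h2 : q.eval₂ φ L = C (gam p M ![0, 1] ^ (p * p)) * L ^ p + q.eraseLead.eval₂ φ L := by
      conv_lhs => rw [hsplit]
      rw [Polynomial.eval₂_add, Polynomial.eval₂_mul, Polynomial.eval₂_C, Polynomial.eval₂_X_pow]
      congr 2
      exact rename_C _ _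
    have h3 : aeval (gens p M) ((C (gam p M ![0, 2]) * X 0 ^ (p - 1)) ^ (p ^ 2) * X 3) =
        (C (gam p M ![0, 2]) * varX F ^ (p - 1)) ^ (p ^ 2) * orbitNorm p M (varZ F) := by
      simp only [map_mul, map_pow, aeval_gens_C, aeval_gens_X_zero, aeval_gens_X_three]
    rw [← h3, h2, ← sub_eq_zero, ← map_sub] at h1
    rw [← h1, hLp, C_mul]
    congr 1
    ring

/-- A relation which up to a scalar is monic of degree `p` in `T₂`. -/
theorem exists_monic_relation (hp : 2 < p) (h01 : gam p M ![0, 1] ≠ 0)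
    (h02 : gam p M ![0, 2] ≠ 0) :
    ∃ r : MvPolynomial (Fin 4) F, degreeOf 2 r < p ∧ aeval (gens p M) (X 2 ^ p + r) = 0 := by
  obtain ⟨i, c, r, hc, hr, h0⟩ := exists_relation hp h01 h02
  -- While i > 0 the value of `r` is divisible by x, so T₀ divides `r` and can be cancelled from the
  -- whole relation.
  induction i generalizing r with
  | zero =>
    refine ⟨C c⁻¹ * r, lt_of_le_of_lt (degreeOf_C_mul_le _ _ _) hr, ?_⟩
    have h1 : (X 2 ^ p + C c⁻¹ * r : MvPolynomial (Fin 4) F) =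
        C c⁻¹ * (C c * X 0 ^ 0 * X 2 ^ p + r) := by
      linear_combination -(X 2 ^ p) * C_mul_inv_cancel (σ := Fin 4) hc
    rw [h1, map_mul, h0, mul_zero]
  | succ i ih =>
    have hdvd : varX F ∣ aeval (gens p M) r := by
      rw [map_add] at h0
      rw [eq_neg_of_add_eq_zero_right h0, dvd_neg]
      simp only [map_mul, map_pow, aeval_gens_X_zero, aeval_gens_C]
      exact Dvd.dvd.mul_right (Dvd.dvd.mul_left (dvd_pow_self _ (Nat.succ_ne_zero i)) _) _
    obtain ⟨s, rfl⟩ := X_zero_dvd_of_varX_dvd hp h01 h02 hr hdvd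
    rw [mul_comm, degreeOf_mul_X_of_ne _ (by decide)] at hr
    refine ih s hr ?_
    have h1 : (C c * X 0 ^ (i + 1) * X 2 ^ p + X 0 * s : MvPolynomial (Fin 4) F) =
        X 0 * (C c * X 0 ^ i * X 2 ^ p + s) := by ring
    rw [h1, map_mul, aeval_gens_X_zero] at h0
    exact (mul_eq_zero.1 h0).resolve_left varX_ne_zero

end Relation

/-! ### Normal forms and the main theorem -/

section NormalForm

variable {p : ℕ} {F : Type*} [Field F]

/-- Division by a polynomial which is monic of degree `p` in one of the variables. -/
theorem exists_eq_mul_add_degreeOf_lt {ι : Type*} (i : ι) (hp : 0 < p) {r : MvPolynomial ι F}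
    (hr : degreeOf i r < p) (h : MvPolynomial ι F) :
    ∃ q s, h = (X i ^ p + r) * q + s ∧ degreeOf i s < p := by
  induction hn : degreeOf i h using Nat.strong_induction_on generalizing h with
  | _ n ih =>
    by_cases hlt : degreeOf i h < p
    · exact ⟨0, h, by ring, hlt⟩
    set a := h.divMonomial (Finsupp.single i p) with ha
    set b := h.modMonomial (Finsupp.single i p) with hb
    have hdec : X i ^ p * a + b = h := by
      rw [X_pow_eq_monomial]
      exact divMonomial_add_modMonomial h _
    have hadeg : degreeOf i a ≤ n - p := by
      rw [degreeOf_le_iff]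
      intro J hJ
      rw [mem_support_iff, ha, coeff_divMonomial, ← mem_support_iff] at hJ
      have := monomial_le_degreeOf i hJ
      simp at this
      omega
    have hbdeg : degreeOf i b < p := by
      rw [degreeOf_lt_iff hp]
      intro J hJ
      by_contra hge
      rw [mem_support_iff, hb] at hJ
      exact hJ (coeff_modMonomial_of_le h (Finsupp.single_le_iff.2 (not_lt.1 hge)))
    -- Subtracting `(X i ^ p + r) * a` from `h` leaves `b - a * r`.
    have hlt' : degreeOf i (b - a * r) < n := by
      refine lt_of_le_of_lt (degreeOf_sub_le i _ _) (max_lt (by omega) ?_)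
      exact lt_of_le_of_lt (degreeOf_mul_le i _ _) (by omega)
    obtain ⟨q, s, hqs, hs⟩ := ih _ hlt' _ rfl
    exact ⟨a + q, s, by linear_combination hqs - hdec, hs⟩

/-- A multiple of a polynomial monic of degree `p` in one variable, all of whose monomials that are
divisible by the `p`-th power of this variable are equal to this power, is a multiple by a
constant. -/
theorem eq_C_of_mul_eq {ι : Type*} {i : ι} {r R U : MvPolynomial ι F}
    (hr : degreeOf i r < p) (hR : R = (X i ^ p + r) * U)
    (hdeg : ∀ I ∈ R.support, p ≤ I i → I = Finsupp.single i p) : ∃ c, U = C c := by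
  classical
  by_cases hU : U = 0
  · exact ⟨0, by simp [hU]⟩
  have h0 : degreeOf i (X i ^ p + r) = p := by
    rw [degreeOf_add_eq_of_degreeOf_lt] <;> rw [degreeOf_X_self_pow]
    exact hr
  have hne : X i ^ p + r ≠ 0 := fun h => by
    rw [h, degreeOf_zero] at h0
    omega
  have hRdeg : degreeOf i R ≤ p := by
    rw [degreeOf_le_iff]
    intro I hI
    by_contra hlt
    rw [hdeg I hI (by omega)] at hlt
    simp at hlt
  have hU0 : degreeOf i U = 0 := by
    rw [hR, degreeOf_mul_eq hne hU, h0] at hRdeg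
    omega
  have hrU : degreeOf i (r * U) < p := lt_of_le_of_lt (degreeOf_mul_le i _ _) (by omega)
  refine ⟨U.coeff 0, ?_⟩
  ext J
  rw [coeff_C]
  split_ifs with hJ
  · rw [hJ]
  · by_contra hJU
    -- `U` is free of the variable `X i`, so `r * U` has too low a degree in it to contribute here.
    have h1 : R.coeff (Finsupp.single i p + J) = U.coeff J := by
      have h2 : (r * U).coeff (Finsupp.single i p + J) = 0 := by
        by_contra h
        have := monomial_le_degreeOf i (mem_support_iff.2 h)
        simp at this
        omega
      rw [hR, add_mul, coeff_add, h2, add_zero, X_pow_eq_monomial, coeff_monomial_mul, one_mul]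
    have h3 := hdeg (Finsupp.single i p + J) (mem_support_iff.2 (by rwa [h1])) (by simp)
    exact hJ (add_eq_left.1 h3).symm

end NormalForm

/-! ### Generation, lead monomials and the ideal of relations -/

section Main

variable {p : ℕ} [Fact p.Prime] {F : Type*} [Field F] [Algebra (ZMod p) F]
  {M : Matrix (Fin 2) (Fin 2) F}

theorem exists_normalForm (hp : 2 < p) (h01 : gam p M ![0, 1] ≠ 0) (h02 : gam p M ![0, 2] ≠ 0)
    (h : MvPolynomial (Fin 4) F) :
    ∃ s : MvPolynomial (Fin 4) F, aeval (gens p M) h = aeval (gens p M) s ∧ degreeOf 2 s < p := by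
  obtain ⟨r, hr, h0⟩ := exists_monic_relation hp h01 h02
  obtain ⟨q, s, hqs, hs⟩ := exists_eq_mul_add_degreeOf_lt 2 (by omega) hr h
  exact ⟨s, by rw [hqs, map_add, map_mul, h0, zero_mul, zero_add], hs⟩

/-- A normal form with value divisible by x is divisible by T₀, and the quotient has the required
value. -/
theorem mem_range_of_varX_mul_mem (hp : 2 < p) (h01 : gam p M ![0, 1] ≠ 0)
    (h02 : gam p M ![0, 2] ≠ 0) {f : MvPolynomial (Fin 3) F}
    (hf : varX F * f ∈ (aeval (R := F) (gens p M)).range) :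
    f ∈ (aeval (R := F) (gens p M)).range := by
  obtain ⟨h, hh⟩ := hf
  obtain ⟨s, hs, hdeg⟩ := exists_normalForm hp h01 h02 h
  have hs' : aeval (gens p M) s = varX F * f := hs.symm.trans hh
  obtain ⟨t, rfl⟩ := X_zero_dvd_of_varX_dvd hp h01 h02 hdeg ⟨f, hs'⟩
  rw [map_mul, aeval_gens_X_zero] at hs'
  exact ⟨t, mul_left_cancel₀ varX_ne_zero hs'⟩

/-- A multiple of an invariant by a scalar and a power of x is a polynomial in x, f₁ and N(y), hence
in the generators; the factors x are then removed one by one. -/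
theorem range_aeval_gens (hp : 2 < p) (h01 : gam p M ![0, 1] ≠ 0) (h02 : gam p M ![0, 2] ≠ 0) :
    (aeval (R := F) (gens p M)).range = invariants p M := by
  refine le_antisymm ?_ fun f hf => ?_
  · rw [← Algebra.adjoin_range_eq_range_aeval, Algebra.adjoin_le_iff]
    rintro _ ⟨i, rfl⟩
    exact gens_mem_invariants hp h01 h02 i
  obtain ⟨k, H, hH⟩ := exists_coordHom_eq (M := M) hp h01 f
  have hmem : coordHom p M H ∈ invariants p M := by
    rw [← hH]
    exact mul_mem (pow_mem (mul_mem (C_mem_invariants _) (pow_mem varX_mem_invariants _)) _) hf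
  obtain ⟨q, rfl⟩ := exists_comp_of_coordHom_mem hp h01 h02 hmem
  obtain ⟨α, e, b, -, hn⟩ := exists_coordHom_normPoly_eq hp h01 h02
  have hq : coordHom p M (q.comp (normPoly (shiftHom p M))) ∈
      (aeval (R := F) (gens p M)).range := by
    clear hH hmem
    induction q using Polynomial.induction_on' with
    | add s t hs ht =>
      rw [Polynomial.add_comp, map_add]
      exact add_mem hs ht
    | monomial k c =>
      rw [Polynomial.monomial_comp, map_mul, map_pow, coordHom_C, hn, ← aeval_gens_rename]
      exact mul_mem (AlgHom.mem_range_self _ _) (pow_mem (AlgHom.mem_range_self _ _) _)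
  rw [← hH, mul_pow, ← pow_mul, ← C_pow] at hq
  have hx : varX F ^ ((p - 1) * k) * f ∈ (aeval (R := F) (gens p M)).range := by
    have h := Subalgebra.smul_mem _ hq (gam p M ![0, 2] ^ k)⁻¹
    rwa [smul_eq_C_mul, ← mul_assoc, ← mul_assoc, ← C_mul, inv_mul_cancel₀ (pow_ne_zero _ h02), C_1,
      one_mul] at h
  clear hH hq hmem
  generalize (p - 1) * k = n at hx
  induction n with
  | zero => rwa [pow_zero, one_mul] at hx
  | succ n ih =>
    refine ih (mem_range_of_varX_mul_mem hp h01 h02 ?_)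
    rwa [← mul_assoc, ← pow_succ']

/-- In a normal form the products of generators have distinct lead monomials, so the largest
survives. -/
theorem exists_degree_eq_leadExp (hp : 2 < p) (h01 : gam p M ![0, 1] ≠ 0)
    (h02 : gam p M ![0, 2] ≠ 0) (f : MvPolynomial (Fin 3) F) (hf : f ∈ invariants p M)
    (hne : f ≠ 0) : ∃ I, grevlex.degree f = leadExp grevlex (gens p M) I := by
  rw [← range_aeval_gens hp h01 h02] at hf
  obtain ⟨h, rfl⟩ := hf
  obtain ⟨s, hs, hdeg⟩ := exists_normalForm hp h01 h02 h
  change aeval (gens p M) h ≠ 0 at hne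
  change ∃ I, grevlex.degree (aeval (gens p M) h) = _
  rw [hs] at hne ⊢
  obtain ⟨-, I, -, hI⟩ := (hasGensLead_gens hp h01 h02).aeval_ne_zero hp
    (fun h0 => hne (by rw [h0, map_zero])) hdeg
  exact ⟨I, hI⟩

variable (p M) in
/-- The tête-à-tête `γ₁₃^p f₁^{p+2} - γ₁₂² f₂^p`. -/
abbrev teteATete : MvPolynomial (Fin 3) F :=
  C (gam p M ![0, 2]) ^ p * fOne p M ^ (p + 2) - C (gam p M ![0, 1]) ^ 2 * fTwo p M ^ p

/-- Both products have lead term γ₁₂^{p+2}γ₁₃^p y^{p(p+2)}, so these cancel. -/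
theorem degree_teteATete_lt (hp : 2 < p) (h01 : gam p M ![0, 1] ≠ 0)
    (h02 : gam p M ![0, 2] ≠ 0) :
    grevlex.toSyn (grevlex.degree (teteATete p M)) <
      grevlex.toSyn (Finsupp.single 1 (p * (p + 2))) := by
  have hd1 : grevlex.degree (fOne p M) = Finsupp.single 1 p := (hasGensLead_gens hp h01 h02).one
  have hd2 : grevlex.degree (fTwo p M) = Finsupp.single 1 (p + 2) :=
    (hasGensLead_gens hp h01 h02).two
  have hl1 : grevlex.leadingCoeff (fOne p M) = gam p M ![0, 1] :=
    leadingCoeff_of_isHomogeneous h01 (by omega) (isHomogeneous_fOneTail hp) (fOne_eq hp h01)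
  have hl2 : grevlex.leadingCoeff (fTwo p M) = gam p M ![0, 1] * gam p M ![0, 2] :=
    leadingCoeff_of_isHomogeneous (mul_ne_zero h01 h02) (by omega) (isHomogeneous_fTwoTail hp)
      (fTwo_eq hp h01)
  have hn1 : fOne p M ≠ 0 := (hasGensLead_gens hp h01 h02).ne_zero (by omega) 1
  have hn2 : fTwo p M ≠ 0 := (hasGensLead_gens hp h01 h02).ne_zero (by omega) 2
  have hD1 : grevlex.degree (C (gam p M ![0, 2]) ^ p * fOne p M ^ (p + 2)) =
      Finsupp.single 1 (p * (p + 2)) := by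
    rw [← C_pow, grevlex.degree_mul (C_ne_zero.2 (pow_ne_zero _ h02)) (pow_ne_zero _ hn1),
      grevlex.degree_C, zero_add, grevlex.degree_pow, hd1, Finsupp.smul_single, smul_eq_mul,
      mul_comm]
  have hD2 : grevlex.degree (C (gam p M ![0, 1]) ^ 2 * fTwo p M ^ p) =
      Finsupp.single 1 (p * (p + 2)) := by
    rw [← C_pow, grevlex.degree_mul (C_ne_zero.2 (pow_ne_zero _ h01)) (pow_ne_zero _ hn2),
      grevlex.degree_C, zero_add, grevlex.degree_pow, hd2, Finsupp.smul_single, smul_eq_mul]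
  have hlt : grevlex.leadingTerm (C (gam p M ![0, 2]) ^ p * fOne p M ^ (p + 2)) =
      grevlex.leadingTerm (C (gam p M ![0, 1]) ^ 2 * fTwo p M ^ p) := by
    rw [grevlex.leadingTerm_eq_leadingTerm_iff]
    refine ⟨?_, hD1.trans hD2.symm⟩
    simp only [← C_pow, grevlex.leadingCoeff_mul, grevlex.leadingCoeff_pow, grevlex.leadingCoeff_C,
      hl1, hl2]
    ring
  by_cases h0 : teteATete p M = 0
  · rw [h0, grevlex.degree_zero, grevlex_lt_iff]
    left
    rw [map_zero, Finsupp.degree_single]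
    positivity
  · have := degree_sub_lt_of_leadingTerm_eq hlt h0
    rwa [hD1] at this

/-- The relation read off from a subduction of the tête-à-tête generates the relations. -/
theorem relation_of_subducts (hp : 2 < p) (h01 : gam p M ![0, 1] ≠ 0) (h02 : gam p M ![0, 2] ≠ 0)
    {P : MvPolynomial (Fin 4) F} (hP : Subducts grevlex (gens p M) (teteATete p M) P 0) :
    C (gam p M ![0, 2]) ^ p * X 1 ^ (p + 2) - C (gam p M ![0, 1]) ^ 2 * X 2 ^ p - P ≠ 0 ∧
      RingHom.ker (aeval (R := F) (gens p M)) =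
        Ideal.span {C (gam p M ![0, 2]) ^ p * X 1 ^ (p + 2)
          - C (gam p M ![0, 1]) ^ 2 * X 2 ^ p - P} := by
  classical
  have hlead := hasGensLead_gens (M := M) hp h01 h02
  set R := C (gam p M ![0, 2]) ^ p * X 1 ^ (p + 2) - C (gam p M ![0, 1]) ^ 2 * X 2 ^ p - P with hR
  have hRker : aeval (gens p M) R = 0 := by
    have h := hP.aeval_eq
    rw [add_zero] at h
    simp only [hR, map_sub, map_mul, map_pow, aeval_gens_C, aeval_gens_X_one, aeval_gens_X_two]
    rw [← h, sub_self]
  have hPlt : ∀ I ∈ P.support, grevlex.toSyn (leadExp grevlex (gens p M) I) <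
      grevlex.toSyn (Finsupp.single 1 (p * (p + 2))) := fun I hI =>
    lt_of_le_of_lt (hP.leadExp_le (hlead.ne_zero (by omega)) I hI) (degree_teteATete_lt hp h01 h02)
  have hmon : R = monomial (Finsupp.single 1 (p + 2)) (gam p M ![0, 2] ^ p)
      - monomial (Finsupp.single 2 p) (gam p M ![0, 1] ^ 2) - P := by
    rw [hR, ← C_pow, ← C_pow, C_mul_X_pow_eq_monomial, C_mul_X_pow_eq_monomial]
  have hRne : R ≠ 0 := by
    intro h
    -- The product f₁^{p+2} has lead monomial y^{p(p+2)}, above all those used in the subduction, so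
    -- `P` cannot cancel T₁^{p+2}.
    have hc : P.coeff (Finsupp.single 1 (p + 2)) = 0 := by
      by_contra hc
      have := hPlt _ (mem_support_iff.2 hc)
      have he : leadExp grevlex (gens p M) (Finsupp.single 1 (p + 2)) =
          Finsupp.single 1 (p * (p + 2)) := by
        obtain ⟨h0, h1, h2⟩ := hlead.leadExp_eq (Finsupp.single 1 (p + 2))
        ext i
        fin_cases i
        · simpa using h0
        · simpa using h1
        · simpa using h2
      rw [he] at this
      exact lt_irrefl _ this
    have h1 := congrArg (coeff (Finsupp.single 1 (p + 2))) h
    rw [hmon, coeff_sub, coeff_sub, hc, coeff_monomial, coeff_monomial, if_pos rfl, if_neg,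
      coeff_zero, sub_zero, sub_zero] at h1
    · exact pow_ne_zero _ h02 h1
    · rw [Finsupp.single_eq_single_iff]
      simp
  -- Grevlex refines total degree, so the bound on lead monomials bounds the weighted degree of
  -- every term of `R`.
  have hweight : ∀ I ∈ R.support, I 0 + p * I 1 + (p + 2) * I 2 + p ^ 2 * I 3 ≤ p * (p + 2) := by
    intro I hI
    rw [hmon] at hI
    rcases Finset.mem_union.1 (support_sub _ _ _ hI) with hI | hI
    · rcases Finset.mem_union.1 (support_sub _ _ _ hI) with hI | hI
      · have := Finset.mem_singleton.1 (support_monomial_subset hI)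
        simp [this]
      · have := Finset.mem_singleton.1 (support_monomial_subset hI)
        simp [this, mul_comm]
    · have h := hPlt I hI
      rw [grevlex_lt_iff, hlead.degree_leadExp, Finsupp.degree_single] at h
      omega
  obtain ⟨r, hr, hr0⟩ := exists_monic_relation hp h01 h02
  have hker : ∀ h, aeval (gens p M) h = 0 → X 2 ^ p + r ∣ h := by
    intro h hh
    obtain ⟨q, s, hqs, hs⟩ := exists_eq_mul_add_degreeOf_lt 2 (by omega) hr h
    have hs0 : s = 0 := by
      by_contra hne
      refine (hlead.aeval_ne_zero hp hne hs).1 ?_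
      rwa [hqs, map_add, map_mul, hr0, zero_mul, zero_add] at hh
    exact ⟨q, by rw [hqs, hs0, add_zero]⟩
  obtain ⟨U, hU⟩ := hker R hRker
  -- T₂^p alone already has the maximal weight p(p + 2), so a term with `I 2 ≥ p` has no other
  -- factor.
  obtain ⟨c, rfl⟩ := eq_C_of_mul_eq hr hU fun I hI hge => by
    have hw := hweight I hI
    have h2 : (p + 2) * p ≤ (p + 2) * I 2 := Nat.mul_le_mul_left _ hge
    have h3 : (p + 2) * p = p * (p + 2) := mul_comm _ _
    have e0 : I 0 = 0 := by omega
    have e1 : p * I 1 = 0 := by omega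
    have e3 : p ^ 2 * I 3 = 0 := by omega
    have e2 : (p + 2) * I 2 = (p + 2) * p := by omega
    have e1 : I 1 = 0 := (Nat.mul_eq_zero.1 e1).resolve_left (by omega)
    have e3 : I 3 = 0 := (Nat.mul_eq_zero.1 e3).resolve_left (by positivity)
    have e2 : I 2 = p := Nat.eq_of_mul_eq_mul_left (by omega) e2
    ext i
    fin_cases i
    · simpa using e0
    · simpa using e1
    · simpa using e2
    · simpa using e3
  have hc : c ≠ 0 := by
    rintro rfl
    exact hRne (by rw [hU, C_0, mul_zero])
  refine ⟨hRne, le_antisymm (fun h hh => ?_) ?_⟩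
  · rw [Ideal.mem_span_singleton, hU]
    refine dvd_trans ⟨C c⁻¹, ?_⟩ (hker h hh)
    rw [mul_assoc, C_mul_inv_cancel hc, mul_one]
  · rw [Ideal.span_singleton_le_iff_mem]
    exact hRker

theorem range_gens : Set.range (gens p M) =
    {varX F, fOne p M, fTwo p M, orbitNorm p M (varZ F)} := by
  ext f
  simp only [gens, Matrix.range_cons, Matrix.range_empty, Set.union_empty, Set.singleton_union]

end Main

/-! ### Nonvanishing of γ₁₂ and γ₁₃ for the generic matrix -/

section Generic

variable (p : ℕ) [Fact p.Prime]

theorem gam_zero_one_genMat_ne_zero : gam p (genMat p) ![0, 1] ≠ 0 := by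
  rw [gam_zero_one]
  simp only [genMat, Matrix.of_apply, ← map_mul, ← map_sub]
  rw [map_ne_zero_iff _ (IsFractionRing.injective _ _)]
  intro h
  -- Specialise to the identity matrix.
  have := congrArg (aeval fun ij : Fin 2 × Fin 2 => if ij.1 = ij.2 then (1 : ZMod p) else 0) h
  simp at this

theorem gam_zero_two_genMat_ne_zero : gam p (genMat p) ![0, 2] ≠ 0 := by
  rw [gam_zero_two]
  simp only [genMat, Matrix.of_apply, ← map_pow, ← map_mul, ← map_sub]
  rw [map_ne_zero_iff _ (IsFractionRing.injective _ _)]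
  intro h
  -- Specialise the first column to 1 and the second to an indeterminate X; γ₁₃ becomes X^p - X.
  have := congrArg (aeval fun ij : Fin 2 × Fin 2 =>
    if ij.2 = 0 then (1 : Polynomial (ZMod p)) else Polynomial.X) h
  simp at this
  exact FiniteField.X_pow_card_sub_X_ne_zero (ZMod p) (Fact.out : p.Prime).one_lt this

end Generic

end

theorem mainTheorem8 (p : ℕ) [Fact p.Prime] (hp : 2 < p) :
    -- the division in the definition of `f₂` is exact
    (2 * varX (GenField p) ^ (p - 2) * fTwo p (genMat p) =
      C (gam p (genMat p) ![0, 1]) * fMinor p (genMat p) ![0, 1, 3] + fOne p (genMat p) ^ 2) ∧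
    -- `{x, f₁, f₂, N_G(z)}` is a SAGBI basis of the ring of invariants, and generates it
    IsSagbiBasis grevlex (invariants p (genMat p))
      {varX (GenField p), fOne p (genMat p), fTwo p (genMat p),
        orbitNorm p (genMat p) (varZ (GenField p))} ∧
    Algebra.adjoin (GenField p)
      {varX (GenField p), fOne p (genMat p), fTwo p (genMat p),
        orbitNorm p (genMat p) (varZ (GenField p))} = invariants p (genMat p) ∧
    -- the tête-à-tête subducts to zero
    (∃ P : MvPolynomial (Fin 4) (GenField p),
      Subducts grevlex (gens p (genMat p))
        (C (gam p (genMat p) ![0, 2]) ^ p * fOne p (genMat p) ^ (p + 2)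
          - C (gam p (genMat p) ![0, 1]) ^ 2 * fTwo p (genMat p) ^ p) P 0) ∧
    -- and the relation read off from the subduction generates the (nonzero) ideal of relations
    ∀ P : MvPolynomial (Fin 4) (GenField p),
      Subducts grevlex (gens p (genMat p))
        (C (gam p (genMat p) ![0, 2]) ^ p * fOne p (genMat p) ^ (p + 2)
          - C (gam p (genMat p) ![0, 1]) ^ 2 * fTwo p (genMat p) ^ p) P 0 →
      C (gam p (genMat p) ![0, 2]) ^ p * X 1 ^ (p + 2)
          - C (gam p (genMat p) ![0, 1]) ^ 2 * X 2 ^ p - P ≠ 0 ∧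
      RingHom.ker (aeval (R := GenField p) (gens p (genMat p))) =
        Ideal.span {C (gam p (genMat p) ![0, 2]) ^ p * X 1 ^ (p + 2)
          - C (gam p (genMat p) ![0, 1]) ^ 2 * X 2 ^ p - P} := by
  have h01 := gam_zero_one_genMat_ne_zero p
  have h02 := gam_zero_two_genMat_ne_zero p
  have hne := (hasGensLead_gens hp h01 h02).ne_zero (by omega)
  have hmem := gens_mem_invariants hp h01 h02
  have hA := exists_degree_eq_leadExp hp h01 h02
  refine ⟨two_mul_fTwo hp h01, ?_, ?_, ?_, fun P hP => relation_of_subducts hp h01 h02 hP⟩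
  · rw [← range_gens]
    exact isSagbiBasis_range hne hmem hA
  · rw [← range_gens, Algebra.adjoin_range_eq_range_aeval]
    exact range_aeval_gens hp h01 h02
  · refine exists_subducts_zero hne hmem hA _ (sub_mem (mul_mem ?_ ?_) (mul_mem ?_ ?_))
    · exact pow_mem (C_mem_invariants _) _
    · exact pow_mem (hmem 1) _
    · exact pow_mem (C_mem_invariants _) _
    · exact pow_mem (hmem 2) _
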